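/- **Setting.** Let $(X,d)$ be a Polish metric space with its Borel $\sigma$-algebra and let $m=(m_x)_{x\in X}$ be a random walk on $X$: a family of Borel probability measures depending measurably on $x$ (i.e. $x\mapsto m_x(A)$ is Borel for each Borel $A$), each with finite first moment, $\int_X d(z,y)\,dm_x(y)<\infty$ for $x,z\in X$. Let $\nu$ be a nonzero finite Borel measure on $X$ that is reversible for $m$, i.e. $\int_A m_x(B)\,d\nu(x)=\int_B m_x(A)\,d\nu(x)$ for all Borel $A,B\subset X$, and such that the probability measure $\nu/\nu(X)$ is ergodic with respect to $m$: every Borel set $B$ with $m_x(B)=1$ for all $x\in B$ satisfies $\nu(B)\in\{0,\nu(X)\}$. For $u\in L^2(X,\nu)$ let $$\mathcal F_m(u)=\frac12\int_X\int_X|u(y)-u(x)|\,dm_x(y)\,d\nu(x)\in[0,+\infty],$$ and let $\Delta_1^m$ be the multivalued operator in $L^2(X,\nu)$ given by $v\in\Delta_1^m u$ if and only if $-v\in\partial\mathcal F_m(u)$, where $\partial\mathcal F_m$ is the subdifferential in the Hilbert space $L^2(X,\nu)$. Let $\lambda>0$. For $f,v_0\in L^2(X,\nu)$ and $T>0$,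 a *strong solution in $(0,T)$* of the Cauchy problem $$v_t\in\Delta_1^m v-\lambda(v-f)\ \text{ in }(0,T),\qquad v(0)=v_0, \tag{P}$$ is a function $v\in C([0,T];L^2(X,\nu))\cap W^{1,1}_{\rm loc}(0,T;L^2(X,\nu))$ with $v(0)=v_0$ $\nu$-a.e. and $\lambda(v(t)-f)+v_t(t)\in\Delta_1^m(v(t))$ for almost every $t\in(0,T)$. **Theorem.** 1. For every $f\in L^2(X,\nu)$, every $v_0\in L^2(X,\nu)$ and every $T>0$ there exists a unique strong solution of (P) in $(0,T)$. 2. Let $f,\hat f\in L^2(X,\nu)$ with $f\le\hat f$ $\nu$-a.e., let $v_0,w_0\in L^2(X,\nu)$ and $T>0$, and let $v$ and $w$ be strong solutions in $(0,T)$ of (P) with initial data $v_0$ and $w_0$ and with $f$ and $\hat f$ in the role of $f$, respectively (and the same $\lambda$). Then, for every $1\le q\le\infty$, $$\|(v(t)-w(t))^+\|_{L^q(X,\nu)}\le\|(v_0-w_0)^+\|_{L^q(X,\nu)}\qquad\text{for all }0<t<T,$$ where the right-hand side may be $+\infty$. -/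

import Mathlib

open MeasureTheory ProbabilityTheory Set
open scoped ENNReal ContDiff

noncomputable section

namespace MetricRandomWalk

variable {X : Type*} [MeasurableSpace X]

/-- A random walk on a metric space: a measurable family of Borel probability measures
`m x` (a Markov kernel), each with finite first moment. -/
structure IsRandomWalk [MetricSpace X] (m : Kernel X X) : Prop where
  isMarkov : IsMarkovKernel m
  finite_first_moment : ∀ x z : X, Integrable (fun y => dist z y) (m x)

/-- An invariant probability measure `π` is ergodic with respect to `m` if `π B ∈ {0, 1}` for
every Borel set `B` that is invariant for the walk, i.e. `m x B = 1` whenever `x ∈ B`. -/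
structure IsErgodic (m : Kernel X X) (π : Measure X) : Prop where
  isProbability : IsProbabilityMeasure π
  invariant : m.Invariant π
  ergodic : ∀ B : Set X, MeasurableSet B → (∀ x ∈ B, m x B = 1) → π B = 0 ∨ π B = 1

/-- The total variation `TV_m(u) = 1/2 ∫∫ |u(y) - u(x)| dm_x(y) dν(x)`. It takes the value `∞`
exactly when the double integral diverges, that is, when `u` is not in `BV_m(X)`. -/
def totalVariation (m : Kernel X X) (ν : Measure X) (u : X → ℝ) : ℝ≥0∞ :=
  (1 / 2) * ∫⁻ x, ∫⁻ y, ENNReal.ofReal |u y - u x| ∂(m x) ∂ν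

/-- The functional `F_m : L²(X, ν) → ]-∞, +∞]`, equal to `TV_m(u)` if `u ∈ BV_m(X)` and to `+∞`
otherwise. -/
def energy (m : Kernel X X) (ν : Measure X) (u : Lp ℝ 2 ν) : EReal :=
  ((totalVariation m ν (fun x => u x) : ℝ≥0∞) : EReal)

/-- The subdifferential at `u` of a function `φ : H → ]-∞, +∞]` on a real Hilbert space. -/
def subdifferential {H : Type*} [NormedAddCommGroup H] [InnerProductSpace ℝ H]
    (φ : H → EReal) (u : H) : Set H :=
  {v | φ u < ⊤ ∧ ∀ w : H, φ u + ((inner ℝ v (w - u) : ℝ) : EReal) ≤ φ w}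

/-- The (multivalued) `1`-Laplacian in `L²(X, ν)`, as a map to sets:
`v ∈ Δ₁ᵐ u` if and only if `-v ∈ ∂F_m(u)`. -/
def oneLaplacian (m : Kernel X X) (ν : Measure X) (u : Lp ℝ 2 ν) : Set (Lp ℝ 2 ν) :=
  {v | -v ∈ subdifferential (energy m ν) u}

/-- `v` belongs to `W^{1,1}_loc(0, T; H)` with weak derivative `g`: both are in
`L¹_loc(0, T; H)` and `∫ φ' v = - ∫ φ g` for all test functions `φ ∈ C_c^∞(0, T)`. -/
structure HasWeakDerivOn {H : Type*} [NormedAddCommGroup H] [NormedSpace ℝ H]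
    (T : ℝ) (v g : ℝ → H) : Prop where
  locallyIntegrable : LocallyIntegrableOn v (Ioo 0 T)
  locallyIntegrable_deriv : LocallyIntegrableOn g (Ioo 0 T)
  integral_by_parts : ∀ φ : ℝ → ℝ, ContDiff ℝ ∞ φ → HasCompactSupport φ →
    tsupport φ ⊆ Ioo 0 T →
      ∫ t in Ioo 0 T, deriv φ t • v t = - ∫ t in Ioo 0 T, φ t • g t

/-- `v` is a strong solution in `(0, T)` of the Cauchy problem
`v_t ∈ Δ₁ᵐ v - lam (v - f)`, `v(0) = v₀`: it lies in
`C([0, T]; L²(X, ν)) ∩ W^{1,1}_loc(0, T; L²(X, ν))`, satisfies `v(0) = v₀`, and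
`lam (v(t) - f) + v_t(t) ∈ Δ₁ᵐ (v(t))` for almost every `t ∈ (0, T)`.
Only the values of `v` on `[0, T]` matter. -/
structure IsStrongSolution (m : Kernel X X) (ν : Measure X) (lam : ℝ) (f v₀ : Lp ℝ 2 ν)
    (T : ℝ) (v : ℝ → Lp ℝ 2 ν) : Prop where
  continuousOn : ContinuousOn v (Icc 0 T)
  initial : v 0 = v₀
  inclusion : ∃ v' : ℝ → Lp ℝ 2 ν, HasWeakDerivOn T v v' ∧
    ∀ᵐ t ∂(volume.restrict (Ioo 0 T)), lam • (v t - f) + v' t ∈ oneLaplacian m ν (v t)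

end MetricRandomWalk

end

/-! Reversibility makes `ν` invariant, so both marginals of `ν ⊗ₘ m` equal `ν`. Hence the energy is
at most the `L¹` norm, thus at most `√(ν X) ‖u‖₂`: it is a finite continuous seminorm `p` on `L²`,
and (P) is the gradient flow of `p + lam / 2 ‖· - f‖²`.

Existence. The set `∂p(0)` is closed, convex and bounded, and `p` is its support function.
Projecting `μ⁻¹ u` onto it gives a bounded Lipschitz field that is a subgradient of `p` at `u` up to
an error `μ L²` (`exists_lipschitz_approx_subgradient`). The corresponding ODEs have solutions with
a common Lipschitz constant, and monotonicity makes them Cauchy as `μ → 0`. The limit satisfies a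
local evolution variational inequality (`exists_curve_evolution_inequality`). A Lipschitz curve in a
separable Hilbert space is weakly differentiable almost everywhere, and differentiating the
inequality yields the inclusion (`exists_gradient_flow`).

Comparison. If `φ` is nondecreasing and 1-Lipschitz and `P = φ(u - w)`, then `p (u - P) + p (w + P)
≤ p u + p w` (`tvSeminorm_sub_add_tvSeminorm_add_le`). With `φ` the truncation of `(r - k)⁺` at
height `h`, testing the two inclusions with `v - P` and `w + P` gives `⟪P, v' - w'⟫ ≤ 0`, so the
integral of the primitive of `φ` along `v - w` does not exceed its initial value. Dividing by `h`
and letting `h → 0` bounds `∫ (v - w - k)⁺` by its initial value for every `k ≥ 0`, and these bounds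
together control every `L^q` norm of the positive part. Uniqueness is the case `q = 1` applied in
both directions. -/

namespace MetricRandomWalk

open Filter Topology
open scoped RealInnerProductSpace NNReal

/-! ### Subgradients of a continuous seminorm and their Yosida approximation. -/

section Polar

variable {H : Type*} [NormedAddCommGroup H] [InnerProductSpace ℝ H]

/-- The convex set of vectors `ξ` dominated by the seminorm `p`, i.e. `∂p(0)`. -/
def polarSet (p : Seminorm ℝ H) : Set H := {ξ | ∀ w, ⟪ξ, w⟫ ≤ p w}

theorem zero_mem_polarSet (p : Seminorm ℝ H) : (0 : H) ∈ polarSet p := fun w => by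
  simp

theorem convex_polarSet (p : Seminorm ℝ H) : Convex ℝ (polarSet p) := by
  intro x hx y hy a b ha hb hab w
  rw [inner_add_left, real_inner_smul_left, real_inner_smul_left]
  have h1 := mul_le_mul_of_nonneg_left (hx w) ha
  have h2 := mul_le_mul_of_nonneg_left (hy w) hb
  have : a * p w + b * p w = p w := by rw [← add_mul, hab, one_mul]
  linarith

theorem isClosed_polarSet (p : Seminorm ℝ H) : IsClosed (polarSet p) := by
  have : polarSet p = ⋂ w, {ξ | ⟪ξ, w⟫ ≤ p w} := by ext; simp [polarSet]
  rw [this]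
  exact isClosed_iInter fun w => isClosed_le (by fun_prop) continuous_const

theorem norm_le_of_mem_polarSet {p : Seminorm ℝ H} {L : ℝ} (hp : ∀ u, p u ≤ L * ‖u‖)
    (hL : 0 ≤ L) {ξ : H} (hξ : ξ ∈ polarSet p) : ‖ξ‖ ≤ L := by
  have h := (hξ ξ).trans (hp ξ)
  rw [real_inner_self_eq_norm_sq] at h
  rcases (norm_nonneg ξ).eq_or_lt with h0 | h0
  · rw [← h0]; exact hL
  · nlinarith

/-- Hahn–Banach: the functional `c • u ↦ c * p u` on the line through `u` is dominated by `p`, so it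
extends to all of `H` under the same domination; Riesz represents the extension. -/
theorem exists_mem_polarSet_inner_eq [CompleteSpace H] {p : Seminorm ℝ H} {L : ℝ}
    (hp : ∀ u, p u ≤ L * ‖u‖) (u : H) : ∃ η ∈ polarSet p, ⟪η, u⟫ = p u := by
  by_cases hu : u = 0
  · exact ⟨0, zero_mem_polarSet p, by simp [hu]⟩
  obtain ⟨g, hg, hgp⟩ := exists_extension_of_le_sublinear
    (LinearPMap.mkSpanSingleton u (p u) hu) p
    (fun c hc x => by rw [map_smul_eq_mul, Real.norm_of_nonneg hc.le])
    (fun x y => map_add_le_add p x y) (by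
      rintro ⟨x, hx⟩
      obtain ⟨c, rfl⟩ := Submodule.mem_span_singleton.1 hx
      rw [LinearPMap.mkSpanSingleton'_apply]
      simp only [RingHom.id_apply, smul_eq_mul, map_smul_eq_mul]
      exact mul_le_mul_of_nonneg_right (le_abs_self c) (apply_nonneg p u))
  have hbound : ∀ x, ‖g x‖ ≤ L * ‖x‖ := by
    intro x
    rw [Real.norm_eq_abs, abs_le]
    have h1 := (hgp (-x)).trans (hp (-x))
    have h2 := (hgp x).trans (hp x)
    rw [map_neg, norm_neg] at h1
    constructor <;> linarith
  refine ⟨(InnerProductSpace.toDual ℝ H).symm (g.mkContinuous L hbound), fun w => ?_, ?_⟩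
  · rw [InnerProductSpace.toDual_symm_apply]
    exact hgp w
  · rw [InnerProductSpace.toDual_symm_apply]
    have := hg ⟨u, Submodule.mem_span_singleton_self u⟩
    rw [LinearPMap.mkSpanSingleton_apply] at this
    exact this

/-- The Yosida approximation of `∂p` for a continuous seminorm `p`: a Lipschitz selection of
approximate subgradients, obtained by projecting `μ⁻¹ u` on the polar set. -/
theorem exists_lipschitz_approx_subgradient [CompleteSpace H] {p : Seminorm ℝ H} {L : ℝ}
    (hp : ∀ u, p u ≤ L * ‖u‖) (hL : 0 ≤ L) {μ : ℝ} (hμ : 0 < μ) :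
    ∃ A : H → H, (∃ K : ℝ≥0, LipschitzWith K A) ∧ (∀ u, ‖A u‖ ≤ L) ∧
      ∀ u w, ⟪A u, w - u⟫ ≤ p w - p u + μ * L ^ 2 := by
  choose P hPmem hPmin using exists_norm_eq_iInf_of_complete_convex
    ⟨0, zero_mem_polarSet p⟩ (isClosed_polarSet p).isComplete (convex_polarSet p)
  have hvar : ∀ u, ∀ w ∈ polarSet p, ⟪u - P u, w - P u⟫ ≤ 0 := fun u =>
    (norm_eq_iInf_iff_real_inner_le_zero (convex_polarSet p) (hPmem u)).1 (hPmin u)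
  have hPlip : LipschitzWith 1 P := by
    refine LipschitzWith.of_dist_le_mul fun x y => ?_
    rw [NNReal.coe_one, one_mul, dist_eq_norm, dist_eq_norm]
    have h1 := hvar x (P y) (hPmem y)
    have h2 := hvar y (P x) (hPmem x)
    have h3 : ‖P x - P y‖ ^ 2 ≤ ⟪x - y, P x - P y⟫ := by
      have : ⟪x - y, P x - P y⟫ - ‖P x - P y‖ ^ 2
          = -⟪x - P x, P y - P x⟫ - ⟪y - P y, P x - P y⟫ := by
        rw [← real_inner_self_eq_norm_sq]
        simp only [inner_sub_left, inner_sub_right]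
        ring
      linarith
    have h4 := h3.trans (real_inner_le_norm _ _)
    rcases (norm_nonneg (P x - P y)).eq_or_lt with h0 | h0
    · rw [← h0]; exact norm_nonneg _
    · nlinarith
  have hnorm : ∀ u, ‖P u‖ ≤ L := fun u => norm_le_of_mem_polarSet hp hL (hPmem u)
  refine ⟨fun u => P (μ⁻¹ • u), ⟨1 * ‖μ⁻¹‖₊, hPlip.comp (lipschitzWith_smul _)⟩,
    fun u => hnorm _, fun u w => ?_⟩
  obtain ⟨η, hη, hηu⟩ := exists_mem_polarSet_inner_eq hp u
  set ξ := P (μ⁻¹ • u)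
  -- The projection inequality is tested with the `η` at which `p u` is attained: it reads `μ⁻¹ (p u
  -- - ⟪ξ, u⟫) ≤ ⟪ξ, η⟫ - ‖ξ‖²`, whose right side is at most `L²`. This is the source of the error
  -- `μ L²`.
  have h1 : ⟪μ⁻¹ • u - ξ, η - ξ⟫ ≤ 0 := hvar (μ⁻¹ • u) η hη
  have h2 : p u ≤ ⟪ξ, u⟫ + μ * L ^ 2 := by
    have h3 : ⟪μ⁻¹ • u - ξ, η - ξ⟫ = μ⁻¹ * (p u - ⟪ξ, u⟫) - ⟪ξ, η⟫ + ‖ξ‖ ^ 2 := by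
      rw [← hηu, ← real_inner_self_eq_norm_sq]
      simp only [inner_sub_left, inner_sub_right, real_inner_smul_left]
      rw [real_inner_comm u η, real_inner_comm u ξ]
      ring
    rw [h3] at h1
    have h4 : ⟪ξ, η⟫ ≤ L ^ 2 := by
      calc ⟪ξ, η⟫ ≤ ‖ξ‖ * ‖η‖ := real_inner_le_norm _ _
        _ ≤ L * L := mul_le_mul (hnorm _) (norm_le_of_mem_polarSet hp hL hη) (norm_nonneg _) hL
        _ = L ^ 2 := (sq L).symm
    have h5 : μ⁻¹ * (p u - ⟪ξ, u⟫) ≤ L ^ 2 := by nlinarith [sq_nonneg ‖ξ‖]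
    have h6 := mul_le_mul_of_nonneg_left h5 hμ.le
    rw [mul_inv_cancel_left₀ hμ.ne'] at h6
    linarith
  have h7 : ⟪ξ, w⟫ ≤ p w := hPmem _ w
  rw [inner_sub_right]
  linarith

end Polar

/-! ### The regularised flows and their limit. -/

section ApproximateFlow

theorem sub_le_mul_sub_of_hasDerivWithinAt_le {h h' : ℝ → ℝ} {a b C : ℝ}
    (hh : ∀ t ∈ Icc a b, HasDerivWithinAt h (h' t) (Icc a b) t)
    (hC : ∀ t ∈ Icc a b, h' t ≤ C) {s t : ℝ} (hs : s ∈ Icc a b) (ht : t ∈ Icc a b)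
    (hst : s ≤ t) : h t - h s ≤ C * (t - s) := by
  have hd : ∀ x ∈ interior (Icc a b), HasDerivAt h (h' x) x := fun x hx =>
    (hh x (interior_subset hx)).hasDerivAt (mem_interior_iff_mem_nhds.1 hx)
  exact (convex_Icc a b).image_sub_le_mul_sub_of_deriv_le
    (fun x hx => (hh x hx).continuousWithinAt)
    (fun x hx => (hd x hx).differentiableAt.differentiableWithinAt)
    (fun x hx => (hd x hx).deriv.le.trans (hC x (interior_subset hx))) s hs t ht hst

variable {H : Type*} [NormedAddCommGroup H] [InnerProductSpace ℝ H]

/-- The substitution `v = f + exp (-lam t) y` absorbs the unbounded linear term, leaving a field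
bounded by `exp (lam T) L` everywhere, so Picard–Lindelöf reaches the whole of `[0, T]` at once. The
bound on the derivative does not involve `K`, which blows up along the Yosida approximations. -/
theorem exists_solution_lipschitz_perturbation [CompleteSpace H] {A : H → H} {K : ℝ≥0}
    (hA : LipschitzWith K A) {L : ℝ} (hL : ∀ u, ‖A u‖ ≤ L) {lam : ℝ} (hlam : 0 < lam)
    (f v₀ : H) {T : ℝ} (hT : 0 < T) :
    ∃ v : ℝ → H, v 0 = v₀ ∧
      (∀ t ∈ Icc 0 T, HasDerivWithinAt v (-A (v t) - lam • (v t - f)) (Icc 0 T) t) ∧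
      ∀ t ∈ Icc 0 T, ‖-A (v t) - lam • (v t - f)‖
        ≤ L + lam * (‖v₀ - f‖ + Real.exp (lam * T) * L * T) := by
  have hL0 : 0 ≤ L := (norm_nonneg _).trans (hL 0)
  have hM0 : 0 ≤ Real.exp (lam * T) * L := by positivity
  have hcancel : ∀ t, Real.exp (lam * t) * Real.exp (-(lam * t)) = 1 := fun t => by
    rw [← Real.exp_add]; simp
  set F : ℝ → H → H := fun t y =>
    -(Real.exp (lam * t) • A (f + Real.exp (-(lam * t)) • y)) with hF
  have hFle : ∀ t ∈ Icc 0 T, ∀ y, ‖F t y‖ ≤ Real.exp (lam * T) * L := by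
    intro t ht y
    rw [hF, norm_neg, norm_smul, Real.norm_of_nonneg (Real.exp_pos _).le]
    refine mul_le_mul (Real.exp_le_exp.2 ?_) (hL _) (norm_nonneg _) (Real.exp_pos _).le
    exact mul_le_mul_of_nonneg_left ht.2 hlam.le
  have hPL : IsPicardLindelof F (⟨0, by simp [hT.le]⟩ : Icc (0 : ℝ) T) (v₀ - f)
      (Real.toNNReal (Real.exp (lam * T) * L * T)) 0 (Real.toNNReal (Real.exp (lam * T) * L))
      K := by
    refine ⟨fun t _ => LipschitzWith.lipschitzOnWith ?_, fun y _ => ?_, fun t ht y _ => ?_, ?_⟩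
    · refine LipschitzWith.of_dist_le_mul fun x y => ?_
      rw [hF, dist_neg_neg, dist_smul₀, Real.norm_of_nonneg (Real.exp_pos _).le]
      calc _ ≤ Real.exp (lam * t) * (K * dist (f + Real.exp (-(lam * t)) • x)
            (f + Real.exp (-(lam * t)) • y)) :=
            mul_le_mul_of_nonneg_left (hA.dist_le_mul _ _) (Real.exp_pos _).le
        _ = (Real.exp (lam * t) * Real.exp (-(lam * t))) * (K * dist x y) := by
            rw [dist_add_left, dist_smul₀, Real.norm_of_nonneg (Real.exp_pos _).le]
            ring
        _ = K * dist x y := by rw [hcancel, one_mul]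
    · refine Continuous.continuousOn ?_
      have := hA.continuous
      fun_prop
    · rw [Real.coe_toNNReal _ hM0]
      exact hFle t ht y
    · rw [Real.coe_toNNReal _ hM0, Real.coe_toNNReal _ (by positivity)]
      simp [hT.le]
  obtain ⟨y, hy0, hy⟩ := hPL.exists_eq_forall_mem_Icc_hasDerivWithinAt₀
  have hybd : ∀ t ∈ Icc 0 T, ‖y t‖ ≤ ‖v₀ - f‖ + Real.exp (lam * T) * L * T := by
    intro t ht
    have h1 := norm_image_sub_le_of_norm_deriv_le_segment' hy
      (fun x hx => hFle x ⟨hx.1, hx.2.le⟩ _) t ht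
    have h2 : Real.exp (lam * T) * L * (t - 0) ≤ Real.exp (lam * T) * L * T :=
      mul_le_mul_of_nonneg_left (by linarith [ht.2]) hM0
    have h3 : ‖y t‖ ≤ ‖y t - y 0‖ + ‖y 0‖ := by
      simpa using norm_add_le (y t - y 0) (y 0)
    rw [show y 0 = v₀ - f from hy0] at h1 h3
    linarith
  refine ⟨fun t => f + Real.exp (-(lam * t)) • y t, ?_, fun t ht => ?_, fun t ht => ?_⟩
  · simp [show y 0 = v₀ - f from hy0]
  · have he : HasDerivWithinAt (fun t => Real.exp (-(lam * t)))
        (Real.exp (-(lam * t)) * -(lam * 1)) (Icc 0 T) t :=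
      (((hasDerivAt_id t).const_mul lam).neg.exp).hasDerivWithinAt
    convert! (he.smul (hy t ht)).const_add f using 1
    rw [hF]
    simp only [add_sub_cancel_left, smul_neg, smul_smul]
    rw [mul_comm (Real.exp _) (Real.exp _), hcancel, one_smul, sub_eq_add_neg, ← neg_smul]
    congr 2
    ring
  · refine (norm_sub_le _ _).trans ?_
    rw [norm_neg, norm_smul, Real.norm_of_nonneg hlam.le, add_sub_cancel_left, norm_smul,
      Real.norm_of_nonneg (Real.exp_pos _).le]
    refine add_le_add (hL _) (mul_le_mul_of_nonneg_left ?_ hlam.le)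
    refine le_trans ?_ (hybd t ht)
    refine mul_le_of_le_one_left (norm_nonneg _) (Real.exp_le_one_iff.2 ?_)
    have := mul_nonneg hlam.le ht.1
    linarith

theorem hasDerivWithinAt_half_norm_sub_sq {u w : ℝ → H} {u' w' : H} {S : Set ℝ} {t : ℝ}
    (hu : HasDerivWithinAt u u' S t) (hw : HasDerivWithinAt w w' S t) :
    HasDerivWithinAt (fun r => ‖u r - w r‖ ^ 2 / 2) ⟪u t - w t, u' - w'⟫ S t := by
  convert! ((hu.sub hw).norm_sq).div_const 2 using 1
  simp

/-- Construction of the gradient flow of `p + lam / 2 ‖· - f‖²` as a limit of Yosida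
approximations: a Lipschitz curve satisfying the local evolution variational inequality. -/
theorem exists_curve_evolution_inequality [CompleteSpace H] {p : Seminorm ℝ H} {L : ℝ}
    (hp : ∀ u, p u ≤ L * ‖u‖) (hL : 0 ≤ L) {lam : ℝ} (hlam : 0 < lam)
    (f v₀ : H) {T : ℝ} (hT : 0 < T) :
    ∃ v : ℝ → H, v 0 = v₀ ∧ (∃ C : ℝ≥0, LipschitzOnWith C v (Icc 0 T)) ∧
      ∀ s ∈ Ico 0 T, ∀ w, ∀ η > 0, ∀ᶠ t in 𝓝[>] s,
        ‖v t - w‖ ^ 2 / 2 - ‖v s - w‖ ^ 2 / 2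
          ≤ (p w - p (v s) + lam * ⟪v s - f, w - v s⟫ + η) * (t - s) := by
  set ε : ℕ → ℝ := fun n => 1 / ((n : ℝ) + 1) with hε
  have hε0 : ∀ n, 0 < ε n := fun n => Nat.one_div_pos_of_nat
  have hεanti : ∀ {m n}, m ≤ n → ε n ≤ ε m := fun h => Nat.one_div_le_one_div h
  have hεlim : Tendsto ε atTop (𝓝 0) := tendsto_one_div_add_atTop_nhds_zero_nat
  choose A hAlip hAL hAsub using fun n => exists_lipschitz_approx_subgradient hp hL (hε0 n)
  choose K hK using hAlip
  choose v hv0 hv hvL using fun n =>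
    exists_solution_lipschitz_perturbation (hK n) (hAL n) hlam f v₀ hT
  set C := L + lam * (‖v₀ - f‖ + Real.exp (lam * T) * L * T)
  have hC0 : 0 ≤ C := by positivity
  have hlip : ∀ n, LipschitzOnWith C.toNNReal (v n) (Icc 0 T) := fun n =>
    (convex_Icc 0 T).lipschitzOnWith_of_nnnorm_hasDerivWithin_le (hv n) fun t ht => by
      rw [← NNReal.coe_le_coe, coe_nnnorm, Real.coe_toNNReal _ hC0]
      exact hvL n t ht
  -- `Ψ u w` bounds the rate of change of `‖u - w‖² / 2` along the exact flow through `u`; the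
  -- approximate flow costs an extra `ε n * L ^ 2`.
  set Ψ : H → H → ℝ := fun u w => p w - p u + lam * ⟪u - f, w - u⟫ with hΨ
  have hder : ∀ n, ∀ u w, ⟪u - w, -A n u - lam • (u - f)⟫ ≤ Ψ u w + ε n * L ^ 2 := by
    intro n u w
    have h1 := hAsub n u w
    have h2 : ⟪u - w, -A n u - lam • (u - f)⟫ = ⟪A n u, w - u⟫ + lam * ⟪u - f, w - u⟫ := by
      rw [real_inner_comm, ← neg_sub w u, inner_neg_right, inner_sub_left, inner_neg_left,
        real_inner_smul_left]
      ring
    rw [h2]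
    simp only [hΨ]
    linarith
  -- Two approximate flows of index at least `N` start at the same point, and half their squared
  -- distance grows at rate at most `2 L² ε N`. Integrating over `[0, T]` gives this Cauchy modulus.
  set b : ℕ → ℝ := fun N => √(4 * L ^ 2 * T * ε N) with hb
  have hblim : Tendsto b atTop (𝓝 0) := by
    have := (Real.continuous_sqrt.tendsto _).comp (hεlim.const_mul (4 * L ^ 2 * T))
    simpa [Function.comp_def] using this
  have hdist : ∀ t ∈ Icc 0 T, ∀ n m N, N ≤ n → N ≤ m → dist (v n t) (v m t) ≤ b N := by
    intro t ht n m N hn hm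
    rw [dist_eq_norm]
    refine Real.le_sqrt_of_sq_le ?_
    have h1 := sub_le_mul_sub_of_hasDerivWithinAt_le (C := 2 * L ^ 2 * ε N)
      (fun r hr => hasDerivWithinAt_half_norm_sub_sq (hv n r hr) (hv m r hr)) (fun r hr => by
        have h1 := hder n (v n r) (v m r)
        have h2 := hder m (v m r) (v n r)
        have h3 : ⟪v n r - v m r, (-A n (v n r) - lam • (v n r - f))
              - (-A m (v m r) - lam • (v m r - f))⟫
            = ⟪v n r - v m r, -A n (v n r) - lam • (v n r - f)⟫
              + ⟪v m r - v n r, -A m (v m r) - lam • (v m r - f)⟫ := by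
          rw [inner_sub_right, ← neg_sub (v m r) (v n r), inner_neg_left, inner_neg_left]
          ring
        have h4 : Ψ (v n r) (v m r) + Ψ (v m r) (v n r) ≤ 0 := by
          have : Ψ (v n r) (v m r) + Ψ (v m r) (v n r)
              = - (lam * ‖v n r - v m r‖ ^ 2) := by
            rw [← real_inner_self_eq_norm_sq]
            simp only [hΨ, inner_sub_left, inner_sub_right]
            ring
          rw [this]
          have : 0 ≤ lam * ‖v n r - v m r‖ ^ 2 := by positivity
          linarith
        have h5 := mul_le_mul_of_nonneg_right (hεanti hn) (sq_nonneg L)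
        have h6 := mul_le_mul_of_nonneg_right (hεanti hm) (sq_nonneg L)
        rw [h3]
        linarith) (left_mem_Icc.2 hT.le) ht ht.1
    rw [hv0, hv0, sub_self, norm_zero] at h1
    have h7 : 2 * L ^ 2 * ε N * (t - 0) ≤ 2 * L ^ 2 * ε N * T :=
      mul_le_mul_of_nonneg_left (by linarith [ht.2]) (by have := hε0 N; positivity)
    nlinarith
  have hlim : ∀ t, ∃ l, t ∈ Icc 0 T → Tendsto (fun n => v n t) atTop (𝓝 l) := by
    intro t
    by_cases ht : t ∈ Icc 0 T
    · obtain ⟨l, hl⟩ := cauchySeq_tendsto_of_complete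
        (cauchySeq_of_le_tendsto_0 b (hdist t ht) hblim)
      exact ⟨l, fun _ => hl⟩
    · exact ⟨0, fun h => absurd h ht⟩
  choose u hu using hlim
  have hub : ∀ t ∈ Icc 0 T, ∀ n, dist (v n t) (u t) ≤ b n := fun t ht n =>
    le_of_tendsto (tendsto_const_nhds.dist (hu t ht))
      (eventually_atTop.2 ⟨n, fun m hm => hdist t ht n m n le_rfl hm⟩)
  have hulip : LipschitzOnWith C.toNNReal u (Icc 0 T) :=
    LipschitzOnWith.of_dist_le_mul fun x hx y hy =>
      le_of_tendsto ((hu x hx).dist (hu y hy))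
        (Eventually.of_forall fun n => (hlip n).dist_le_mul x hx y hy)
  refine ⟨u, ?_, ⟨_, hulip⟩, fun s hs w η hη => ?_⟩
  · refine tendsto_nhds_unique (hu 0 (left_mem_Icc.2 hT.le)) ?_
    simp [hv0]
  have hpc : Continuous p := by
    refine Seminorm.continuous_of_le (q := L.toNNReal • normSeminorm ℝ H) ?_ fun x => ?_
    · exact continuous_const.mul continuous_norm
    · change p x ≤ L.toNNReal * ‖x‖
      rw [Real.coe_toNNReal _ hL]
      exact hp x
  have hΨc : Continuous fun u => Ψ u w := by
    simp only [hΨ]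
    fun_prop
  -- For large `n` and `r` close to `s`, uniform convergence and continuity of `u` put `v n r` in a
  -- ball around `u s` on which `Ψ · w` exceeds `Ψ (u s) w` by less than `η / 2`; the other half of
  -- `η` absorbs `ε n * L ^ 2`.
  obtain ⟨ρ, hρ, hρΨ⟩ := Metric.eventually_nhds_iff.1
    ((hΨc.tendsto (u s)).eventually (gt_mem_nhds (show Ψ (u s) w < Ψ (u s) w + η / 2 by linarith)))
  have hsI : s ∈ Icc 0 T := ⟨hs.1, hs.2.le⟩
  obtain ⟨δ, hδ, hδu⟩ := Metric.continuousOn_iff.1 hulip.continuousOn s hsI (ρ / 2) (by linarith)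
  have hmem : Ioo s (min T (s + δ)) ∈ 𝓝[>] s :=
    Ioo_mem_nhdsGT (lt_min hs.2 (by linarith))
  filter_upwards [hmem] with t ht
  have htT : t < T := lt_of_lt_of_le ht.2 (min_le_left _ _)
  have htδ : t < s + δ := lt_of_lt_of_le ht.2 (min_le_right _ _)
  have htI : t ∈ Icc 0 T := ⟨hs.1.trans ht.1.le, htT.le⟩
  have hconv : ∀ r ∈ Icc 0 T, Tendsto (fun n => ‖v n r - w‖ ^ 2 / 2) atTop
      (𝓝 (‖u r - w‖ ^ 2 / 2)) := fun r hr =>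
    ((((hu r hr).sub_const w).norm).pow 2).div_const 2
  refine le_of_tendsto ((hconv t htI).sub (hconv s hsI)) ?_
  have hev1 : ∀ᶠ n in atTop, b n < ρ / 2 := hblim.eventually (gt_mem_nhds (by linarith))
  have hev2 : ∀ᶠ n in atTop, ε n * L ^ 2 < η / 2 := by
    have : Tendsto (fun n => ε n * L ^ 2) atTop (𝓝 0) := by simpa using hεlim.mul_const (L ^ 2)
    exact this.eventually (gt_mem_nhds (by linarith))
  filter_upwards [hev1, hev2] with n hn1 hn2
  have hsub : Icc s t ⊆ Icc 0 T := Icc_subset_Icc hs.1 htT.le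
  refine sub_le_mul_sub_of_hasDerivWithinAt_le
    (h' := fun r => ⟪v n r - w, (-A n (v n r) - lam • (v n r - f)) - 0⟫) (a := s) (b := t)
    (fun r hr => hasDerivWithinAt_half_norm_sub_sq ((hv n r (hsub hr)).mono hsub)
      (hasDerivWithinAt_const r (Icc s t) w)) (fun r hr => ?_)
    (left_mem_Icc.2 ht.1.le) (right_mem_Icc.2 ht.1.le) ht.1.le
  have hr : dist (v n r) (u s) < ρ := by
    have h1 := hub r (hsub hr) n
    have h2 := hδu r (hsub hr) (by
      rw [Real.dist_eq, abs_of_nonneg (by linarith [hr.1])]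
      linarith [hr.2])
    have := dist_triangle (v n r) (u r) (u s)
    linarith
  have h3 := hder n (v n r) w
  have h4 := hρΨ hr
  rw [sub_zero]
  change _ ≤ Ψ (u s) w + η
  linarith

end ApproximateFlow

/-! ### Weak derivatives of Lipschitz curves, and existence of the flow. -/

section WeakDerivative

variable {H : Type*} [NormedAddCommGroup H] [InnerProductSpace ℝ H]

/-- Pettis' theorem in a separable Hilbert space, tested on a dense sequence. -/
theorem stronglyMeasurable_of_inner_denseSeq [SecondCountableTopology H] {α : Type*}
    [MeasurableSpace α] {g : α → H}
    (hg : ∀ n, Measurable fun t => ⟪g t, TopologicalSpace.denseSeq H n⟫) :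
    StronglyMeasurable g := by
  let : MeasurableSpace H := borel H
  have : BorelSpace H := ⟨rfl⟩
  set d := TopologicalSpace.denseSeq H
  have hd : DenseRange d := TopologicalSpace.denseRange_denseSeq H
  have hball : ∀ c : H, ∀ r : ℝ, MeasurableSet (g ⁻¹' Metric.closedBall c r) := by
    intro c r
    by_cases hr : 0 ≤ r
    -- A closed ball is cut out by countably many half-spaces whose normals form a dense sequence,
    -- so its preimage is measurable.
    · have : g ⁻¹' Metric.closedBall c r = ⋂ n, {t | ⟪g t, d n⟫ ≤ r * ‖d n‖ + ⟪c, d n⟫} := by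
        ext t
        simp only [mem_preimage, mem_closedBall_iff_norm, mem_iInter, mem_ofPred_eq]
        constructor
        · intro h n
          have h1 := real_inner_le_norm (g t - c) (d n)
          rw [inner_sub_left] at h1
          have := mul_le_mul_of_nonneg_right h (norm_nonneg (d n))
          linarith
        · intro h
          have hall : ∀ z, ⟪g t, z⟫ ≤ r * ‖z‖ + ⟪c, z⟫ := fun z =>
            hd.induction_on (p := fun z => ⟪g t, z⟫ ≤ r * ‖z‖ + ⟪c, z⟫) z
              (isClosed_le (by fun_prop) (by fun_prop)) h
          have h1 := hall (g t - c)
          have h2 : ‖g t - c‖ ^ 2 ≤ r * ‖g t - c‖ := by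
            rw [← real_inner_self_eq_norm_sq, inner_sub_left]
            linarith
          rcases (norm_nonneg (g t - c)).eq_or_lt with h0 | h0
          · rw [← h0]; exact hr
          · nlinarith
      rw [this]
      exact MeasurableSet.iInter fun n => measurableSet_le (hg n) measurable_const
    · rw [Metric.closedBall_eq_empty.2 (not_le.1 hr), preimage_empty]
      exact MeasurableSet.empty
  refine Measurable.stronglyMeasurable (measurable_of_isOpen fun U hU => ?_)
  have hU' : U = ⋃ q : {q : ℕ × ℚ // Metric.closedBall (d q.1) q.2 ⊆ U},
      Metric.closedBall (d q.1.1) q.1.2 := by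
    refine Subset.antisymm (fun x hx => ?_) (iUnion_subset fun q => q.2)
    obtain ⟨ε, hε, hεU⟩ := Metric.isOpen_iff.1 hU x hx
    obtain ⟨q, hq0, hq⟩ := exists_rat_btwn (half_pos hε)
    obtain ⟨n, hn⟩ := hd.exists_dist_lt x hq0
    refine mem_iUnion.2 ⟨⟨(n, q), fun y hy => hεU ?_⟩, Metric.mem_closedBall.2 hn.le⟩
    have h1 := Metric.mem_closedBall.1 hy
    rw [Metric.mem_ball]
    have := dist_triangle y (d n) x
    rw [dist_comm (d n) x] at this
    linarith
  rw [hU', preimage_iUnion]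
  exact MeasurableSet.iUnion fun q => hball _ _

theorem lipschitzWith_inner_const {C : ℝ≥0} {v : ℝ → H} (hv : LipschitzWith C v) (z : H) :
    LipschitzWith (C * ‖z‖₊) fun r => ⟪v r, z⟫ := by
  refine LipschitzWith.of_dist_le_mul fun x y => ?_
  rw [Real.dist_eq, ← inner_sub_left]
  refine (abs_real_inner_le_norm _ _).trans ?_
  rw [← dist_eq_norm, NNReal.coe_mul, coe_nnnorm]
  have := mul_le_mul_of_nonneg_right (hv.dist_le_mul x y) (norm_nonneg z)
  linarith

/-- Weak differentiability of a Lipschitz curve only needs to be tested on a dense sequence. -/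
theorem differentiableAt_inner_of_dense {C : ℝ≥0} {v : ℝ → H} (hv : LipschitzWith C v)
    {d : ℕ → H} (hd : DenseRange d) {t : ℝ}
    (ht : ∀ n, DifferentiableAt ℝ (fun r => ⟪v r, d n⟫) t) (z : H) :
    DifferentiableAt ℝ (fun r => ⟪v r, z⟫) t := by
  suffices h : ∃ l, Tendsto (slope (fun r => ⟪v r, z⟫) t) (𝓝[≠] t) (𝓝 l) by
    obtain ⟨l, hl⟩ := h
    exact (hasDerivAt_iff_tendsto_slope.2 hl).differentiableAt
  rw [← cauchy_map_iff_exists_tendsto, Metric.cauchy_iff]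
  refine ⟨inferInstance, fun ε hε => ?_⟩
  obtain ⟨n, hn⟩ := hd.exists_dist_lt z (show 0 < ε / (4 * (C + 1)) by positivity)
  have hslope : Tendsto (slope (fun r => ⟪v r, d n⟫) t) (𝓝[≠] t) (𝓝 _) :=
    hasDerivAt_iff_tendsto_slope.1 (ht n).hasDerivAt
  -- The Lipschitz bound makes the difference quotients depend on the test vector uniformly in `r`,
  -- so the Cauchy property passes from the dense sequence to `z`.
  have hclose : ∀ r, |slope (fun r => ⟪v r, z⟫) t r - slope (fun r => ⟪v r, d n⟫) t r|
      ≤ ε / 4 := by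
    intro r
    have h1 : slope (fun r => ⟪v r, z⟫) t r - slope (fun r => ⟪v r, d n⟫) t r
        = slope (fun r => ⟪v r, z - d n⟫) t r := by
      simp only [slope_def_field, inner_sub_right]
      ring
    rw [h1, slope_def_field, abs_div, ← Real.dist_eq, ← Real.dist_eq]
    refine div_le_of_le_mul₀ dist_nonneg (by positivity) ?_
    refine ((lipschitzWith_inner_const hv (z - d n)).dist_le_mul r t).trans
      (mul_le_mul_of_nonneg_right ?_ dist_nonneg)
    rw [NNReal.coe_mul, coe_nnnorm, ← dist_eq_norm]
    calc (C : ℝ) * dist z (d n) ≤ (C + 1) * (ε / (4 * (C + 1))) :=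
          mul_le_mul (by linarith) hn.le dist_nonneg (by positivity)
      _ = ε / 4 := by field_simp
  refine ⟨_, image_mem_map (hslope (Metric.ball_mem_nhds _ (show 0 < ε / 4 by positivity))), ?_⟩
  rintro _ ⟨x, hx, rfl⟩ _ ⟨y, hy, rfl⟩
  have h1 := abs_le.1 (hclose x)
  have h2 := abs_le.1 (hclose y)
  have h3 := abs_lt.1 (Metric.mem_ball.1 hx)
  have h4 := abs_lt.1 (Metric.mem_ball.1 hy)
  rw [Real.dist_eq, abs_lt]
  constructor <;> linarith

/-- A Lipschitz curve in a separable Hilbert space has a bounded measurable weak derivative. -/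
theorem exists_weak_deriv_of_lipschitz [CompleteSpace H] [SecondCountableTopology H] {C : ℝ≥0}
    {v : ℝ → H} (hv : LipschitzWith C v) :
    ∃ g : ℝ → H, StronglyMeasurable g ∧ (∀ t, ‖g t‖ ≤ C) ∧
      ∀ᵐ t, ∀ z, HasDerivAt (fun r => ⟪v r, z⟫) ⟪g t, z⟫ t := by
  classical
  set d := TopologicalSpace.denseSeq H
  have hd : DenseRange d := TopologicalSpace.denseRange_denseSeq H
  set G : Set ℝ := {t | ∀ n, DifferentiableAt ℝ (fun r => ⟪v r, d n⟫) t} with hG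
  have hGmeas : MeasurableSet G := by
    have : G = ⋂ n, {t | DifferentiableAt ℝ (fun r => ⟪v r, d n⟫) t} := by ext; simp [hG]
    rw [this]
    exact MeasurableSet.iInter fun n => measurableSet_of_differentiableAt ℝ _
  have hGae : ∀ᵐ t, t ∈ G := by
    rw [hG]
    simp only [mem_ofPred_eq]
    exact ae_all_iff.2 fun n => (lipschitzWith_inner_const hv (d n)).ae_differentiableAt_real
  have hex : ∀ t, ∃ γ : H, ‖γ‖ ≤ C ∧
      (t ∈ G → ∀ z, HasDerivAt (fun r => ⟪v r, z⟫) ⟪γ, z⟫ t) := by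
    intro t
    by_cases ht : t ∈ G
    · have hdiff := differentiableAt_inner_of_dense hv hd ht
      -- At a point of `G` the weak derivative is linear in `z` with norm at most `C`; its Riesz
      -- representative is the value of the derivative.
      let ℓ : H →ₗ[ℝ] ℝ :=
        { toFun := fun z => deriv (fun r => ⟪v r, z⟫) t
          map_add' := fun x y => by
            simp only [inner_add_right]
            exact deriv_fun_add (hdiff x) (hdiff y)
          map_smul' := fun c x => by
            simp only [real_inner_smul_right, RingHom.id_apply, smul_eq_mul]
            exact deriv_const_mul c (hdiff x) }
      have hℓ : ∀ z, ‖ℓ z‖ ≤ C * ‖z‖ := fun z => by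
        have := norm_deriv_le_of_lipschitz (x₀ := t) (lipschitzWith_inner_const hv z)
        rwa [NNReal.coe_mul, coe_nnnorm] at this
      refine ⟨(InnerProductSpace.toDual ℝ H).symm (ℓ.mkContinuous C hℓ), ?_, fun _ z => ?_⟩
      · rw [LinearIsometryEquiv.norm_map]
        exact ℓ.mkContinuous_norm_le C.2 hℓ
      · rw [InnerProductSpace.toDual_symm_apply]
        exact (hdiff z).hasDerivAt
    · exact ⟨0, by simp, fun h => absurd h ht⟩
  choose γ hγC hγ using hex
  refine ⟨G.indicator γ, stronglyMeasurable_of_inner_denseSeq fun n => ?_, fun t => ?_, ?_⟩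
  · have : (fun t => ⟪G.indicator γ t, d n⟫) = G.indicator (deriv fun r => ⟪v r, d n⟫) := by
      ext t
      by_cases ht : t ∈ G
      · rw [indicator_of_mem ht, indicator_of_mem ht, (hγ t ht (d n)).deriv]
      · rw [indicator_of_notMem ht, indicator_of_notMem ht, inner_zero_left]
    rw [this]
    exact (measurable_deriv _).indicator hGmeas
  · exact (norm_indicator_le_norm_self _ _).trans (hγC t)
  · filter_upwards [hGae] with t ht
    rw [indicator_of_mem ht]
    exact hγ t ht

/-- Pairing with a fixed `z` reduces the claim to integration by parts for two absolutely continuous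
real functions; the boundary terms vanish because `φ` is supported inside `(0, T)`. -/
theorem hasWeakDerivOn_of_lipschitz [CompleteSpace H] {C : ℝ≥0}
    {v g : ℝ → H} (hv : LipschitzWith C v) (hg : StronglyMeasurable g) (hgC : ∀ t, ‖g t‖ ≤ C)
    (hvg : ∀ᵐ t, ∀ z, HasDerivAt (fun r => ⟪v r, z⟫) ⟪g t, z⟫ t) {T : ℝ} (hT : 0 < T) :
    HasWeakDerivOn T v g := by
  have hgint : LocallyIntegrable g := (locallyIntegrable_const (C : ℝ)).mono
    hg.aestronglyMeasurable (Eventually.of_forall fun t => by simpa using hgC t)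
  refine ⟨hv.continuous.locallyIntegrable.locallyIntegrableOn _,
    hgint.locallyIntegrableOn _, fun φ hφ hφc hφs => ?_⟩
  have hφ0 : ∀ t, t ∉ Ioo 0 T → φ t = 0 := fun t ht =>
    image_eq_zero_of_notMem_tsupport fun h => ht (hφs h)
  have hφ'c : HasCompactSupport (deriv φ) := hφc.deriv
  have hφ'cont : Continuous (deriv φ) := hφ.continuous_deriv (by simp)
  have hint1 : Integrable (fun t => deriv φ t • v t) (volume.restrict (Ioo 0 T)) :=
    ((hφ'cont.smul hv.continuous).integrable_of_hasCompactSupport hφ'c.smul_right).restrict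
  have hint2 : Integrable (fun t => φ t • g t) (volume.restrict (Ioo 0 T)) :=
    (hgint.integrable_smul_left_of_hasCompactSupport hφ.continuous hφc).restrict
  refine ext_inner_left ℝ fun z => ?_
  rw [inner_neg_right, ← integral_inner hint1 z, ← integral_inner hint2 z,
    ← integral_Ioc_eq_integral_Ioo, ← integral_Ioc_eq_integral_Ioo,
    ← intervalIntegral.integral_of_le hT.le, ← intervalIntegral.integral_of_le hT.le]
  have hac : AbsolutelyContinuousOnInterval φ 0 T :=
    (hφ.of_le (by simp)).contDiffOn.absolutelyContinuousOnInterval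
  have hac' : AbsolutelyContinuousOnInterval (fun r => ⟪v r, z⟫) 0 T :=
    (lipschitzWith_inner_const hv z).lipschitzOnWith.absolutelyContinuousOnInterval
  have key := hac.integral_mul_deriv_eq_deriv_mul hac'
  rw [hφ0 0 (by simp), hφ0 T (by simp)] at key
  have e1 : ∫ x in (0 : ℝ)..T, ⟪z, deriv φ x • v x⟫
      = ∫ x in (0 : ℝ)..T, deriv φ x * ⟪v x, z⟫ := by
    simp_rw [real_inner_smul_right, real_inner_comm]
  have e2 : ∫ x in (0 : ℝ)..T, ⟪z, φ x • g x⟫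
      = ∫ x in (0 : ℝ)..T, φ x * deriv (fun r => ⟪v r, z⟫) x := by
    refine intervalIntegral.integral_congr_ae ?_
    filter_upwards [hvg] with x hx _
    rw [(hx z).deriv, real_inner_smul_right, real_inner_comm]
  rw [e1, e2, key]
  ring

/-- Existence of the gradient flow of `p + lam / 2 ‖· - f‖²` for a continuous seminorm `p`. -/
theorem exists_gradient_flow [CompleteSpace H] [SecondCountableTopology H]
    {p : Seminorm ℝ H} {L : ℝ}
    (hp : ∀ u, p u ≤ L * ‖u‖) (hL : 0 ≤ L) {lam : ℝ} (hlam : 0 < lam)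
    (f v₀ : H) {T : ℝ} (hT : 0 < T) :
    ∃ v g : ℝ → H, v 0 = v₀ ∧ Continuous v ∧ HasWeakDerivOn T v g ∧
      ∀ᵐ t ∂(volume.restrict (Ioo 0 T)), ∀ w,
        p (v t) + ⟪-(lam • (v t - f) + g t), w - v t⟫ ≤ p w := by
  obtain ⟨u, hu0, ⟨C, hC⟩, hu⟩ := exists_curve_evolution_inequality hp hL hlam f v₀ hT
  set v : ℝ → H := IccExtend hT.le ((Icc 0 T).domRestrict u) with hvdef
  have hvu : ∀ t ∈ Icc 0 T, v t = u t := fun t ht => by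
    rw [hvdef, IccExtend_of_mem _ _ ht, domRestrict_apply]
  have hvlip : LipschitzWith C v := by
    have := (lipschitzOnWith_iff_restrict.1 hC).comp (LipschitzWith.projIcc hT.le)
    rwa [mul_one] at this
  obtain ⟨g, hg, hgC, hvg⟩ := exists_weak_deriv_of_lipschitz hvlip
  refine ⟨v, g, (hvu 0 (left_mem_Icc.2 hT.le)).trans hu0, hvlip.continuous,
    hasWeakDerivOn_of_lipschitz hvlip hg hgC hvg hT, ?_⟩
  filter_upwards [ae_restrict_of_ae hvg, ae_restrict_mem measurableSet_Ioo] with s hs hsT w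
  have key : ∀ η > 0, ⟪g s, v s - w⟫ ≤ p w - p (v s) + lam * ⟪v s - f, w - v s⟫ + η := by
    intro η hη
    have hslope := (hs (v s - w)).hasDerivWithinAt (s := Ioi s)
    rw [hasDerivWithinAt_iff_tendsto_slope' (by simp)] at hslope
    refine le_of_tendsto hslope ?_
    filter_upwards [hu s ⟨hsT.1.le, hsT.2⟩ w η hη, Ioo_mem_nhdsGT hsT.2] with t ht htI
    rw [← hvu s ⟨hsT.1.le, hsT.2.le⟩, ← hvu t ⟨hsT.1.le.trans htI.1.le, htI.2.le⟩] at ht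
    rw [slope_def_field, div_le_iff₀ (sub_pos.2 htI.1)]
    refine le_trans ?_ ht
    -- The increment of `‖v - w‖² / 2` is that of the linear functional `⟪·, v s - w⟫` plus a
    -- nonnegative square. Dropping the square leaves a quantity for which weak differentiability
    -- suffices.
    have : ‖v t - w‖ ^ 2 / 2 - ‖v s - w‖ ^ 2 / 2
        = ⟪v t, v s - w⟫ - ⟪v s, v s - w⟫ + ‖v t - v s‖ ^ 2 / 2 := by
      simp only [← real_inner_self_eq_norm_sq, inner_sub_left, inner_sub_right]
      rw [real_inner_comm w (v t), real_inner_comm w (v s), real_inner_comm (v s) (v t)]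
      ring
    rw [this]
    have : 0 ≤ ‖v t - v s‖ ^ 2 / 2 := by positivity
    linarith
  have h1 := le_of_forall_pos_le_add key
  have h2 : ⟪-(lam • (v s - f) + g s), w - v s⟫
      = ⟪g s, v s - w⟫ - lam * ⟪v s - f, w - v s⟫ := by
    rw [← neg_sub w (v s), inner_neg_right, inner_neg_left, inner_add_left, real_inner_smul_left]
    ring
  rw [h2]
  linarith

end WeakDerivative

/-! ### The fundamental theorem of calculus in `W^{1,1}_loc`, by smooth cut-offs. -/

section SmoothStep

/-- The smooth step rising from `0` to `1` on `[a, a + ε]`. -/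
noncomputable def smoothStep (a ε x : ℝ) : ℝ := Real.smoothTransition ((x - a) / ε)

variable {a ε : ℝ}

theorem contDiff_smoothStep : ContDiff ℝ ∞ (smoothStep a ε) :=
  Real.smoothTransition.contDiff.comp ((contDiff_id.sub contDiff_const).div_const ε)

theorem smoothStep_of_le (hε : 0 < ε) {x : ℝ} (hx : x ≤ a) : smoothStep a ε x = 0 :=
  Real.smoothTransition.zero_of_nonpos (div_nonpos_of_nonpos_of_nonneg (by linarith) hε.le)

theorem smoothStep_of_ge (hε : 0 < ε) {x : ℝ} (hx : a + ε ≤ x) : smoothStep a ε x = 1 :=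
  Real.smoothTransition.one_of_one_le (by rw [le_div_iff₀ hε]; linarith)

theorem monotone_smoothStep (hε : 0 < ε) : Monotone (smoothStep a ε) := fun x y hxy =>
  Real.smoothTransition.monotone (div_le_div_of_nonneg_right (by linarith) hε.le)

theorem deriv_smoothStep_nonneg (hε : 0 < ε) (x : ℝ) : 0 ≤ deriv (smoothStep a ε) x :=
  (monotone_smoothStep hε).deriv_nonneg

theorem deriv_smoothStep_eq_zero (hε : 0 < ε) {x : ℝ} (hx : x ∉ Icc a (a + ε)) :
    deriv (smoothStep a ε) x = 0 := by
  rcases lt_or_ge x a with h | h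
  · have : smoothStep a ε =ᶠ[𝓝 x] fun _ => 0 := by
      filter_upwards [Iio_mem_nhds h] with y hy
      exact smoothStep_of_le hε (le_of_lt hy)
    rw [this.deriv_eq, deriv_const]
  · have h' : a + ε < x := not_le.1 fun h' => hx ⟨h, h'⟩
    have : smoothStep a ε =ᶠ[𝓝 x] fun _ => 1 := by
      filter_upwards [Ioi_mem_nhds h'] with y hy
      exact smoothStep_of_ge hε (le_of_lt hy)
    rw [this.deriv_eq, deriv_const]

theorem continuous_deriv_smoothStep : Continuous (deriv (smoothStep a ε)) :=
  contDiff_smoothStep.continuous_deriv (by simp)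

theorem integral_deriv_smoothStep (hε : 0 < ε) :
    ∫ x in a..a + ε, deriv (smoothStep a ε) x = 1 := by
  rw [intervalIntegral.integral_deriv_eq_sub
    (fun x _ => (contDiff_smoothStep.differentiable (by simp)).differentiableAt)
    (continuous_deriv_smoothStep.intervalIntegrable _ _), smoothStep_of_ge hε le_rfl,
    smoothStep_of_le hε le_rfl, sub_zero]

variable {E : Type*} [NormedAddCommGroup E] [NormedSpace ℝ E] {T : ℝ} {v g : ℝ → E}

theorem integrableOn_deriv_smoothStep_smul (hv : ContinuousOn v (Ioo 0 T)) (ha : 0 < a)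
    (hε : 0 < ε) (haT : a + ε < T) :
    IntegrableOn (fun x => deriv (smoothStep a ε) x • v x) (Ioo 0 T) := by
  have hsub : Icc a (a + ε) ⊆ Ioo 0 T := Icc_subset_Ioo ha haT
  refine IntegrableOn.of_forall_sdiff_eq_zero (s := Icc a (a + ε))
    (continuous_deriv_smoothStep.continuousOn.smul (hv.mono hsub)).integrableOn_Icc
    measurableSet_Ioo fun x hx => ?_
  rw [deriv_smoothStep_eq_zero hε hx.2, zero_smul]

/-- The derivative of the step is nonnegative, has integral one and lives on `[a, a + ε]`: an
approximate Dirac mass at `a`. -/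
theorem tendsto_integral_deriv_smoothStep_smul [CompleteSpace E] (hv : ContinuousOn v (Ioo 0 T))
    (ha : a ∈ Ioo 0 T) :
    Tendsto (fun ε => ∫ x in Ioo 0 T, deriv (smoothStep a ε) x • v x) (𝓝[>] 0) (𝓝 (v a)) := by
  rw [Metric.tendsto_nhds]
  intro η hη
  obtain ⟨δ, hδ, hδv⟩ := Metric.continuousOn_iff.1 hv a ha (η / 2) (half_pos hη)
  filter_upwards [Ioo_mem_nhdsGT (show 0 < min δ (T - a) from lt_min hδ (by linarith [ha.2]))]
    with ε hε
  have hε0 : 0 < ε := hε.1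
  have hεδ : ε < δ := hε.2.trans_le (min_le_left _ _)
  have hεT : a + ε < T := by linarith [hε.2.trans_le (min_le_right δ (T - a))]
  have hsub : Icc a (a + ε) ⊆ Ioo 0 T := Icc_subset_Ioo ha.1 hεT
  have hle : a ≤ a + ε := by linarith
  have hint : IntervalIntegrable (fun x => deriv (smoothStep a ε) x • v x) volume a (a + ε) :=
    (continuous_deriv_smoothStep.continuousOn.smul
      (hv.mono (by rw [uIcc_of_le hle]; exact hsub))).intervalIntegrable
  have hint' : IntervalIntegrable (fun x => deriv (smoothStep a ε) x • v a) volume a (a + ε) :=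
    (continuous_deriv_smoothStep.smul continuous_const).intervalIntegrable _ _
  have h1 : ∫ x in Ioo 0 T, deriv (smoothStep a ε) x • v x
      = ∫ x in a..a + ε, deriv (smoothStep a ε) x • v x := by
    rw [intervalIntegral.integral_of_le hle, ← integral_Icc_eq_integral_Ioc]
    refine setIntegral_eq_of_subset_of_forall_sdiff_eq_zero measurableSet_Ioo hsub fun x hx => ?_
    rw [deriv_smoothStep_eq_zero hε0 hx.2, zero_smul]
  have h2 : v a = ∫ x in a..a + ε, deriv (smoothStep a ε) x • v a := by
    rw [intervalIntegral.integral_smul_const, integral_deriv_smoothStep hε0, one_smul]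
  rw [dist_eq_norm, h1]
  rw [h2, ← intervalIntegral.integral_sub hint hint']
  have h3 : ‖∫ x in a..a + ε, (deriv (smoothStep a ε) x • v x - deriv (smoothStep a ε) x • v a)‖
      ≤ ∫ x in a..a + ε, deriv (smoothStep a ε) x * (η / 2) := by
    refine intervalIntegral.norm_integral_le_of_norm_le hle (Eventually.of_forall fun x hx => ?_)
      ((continuous_deriv_smoothStep.mul continuous_const).intervalIntegrable _ _)
    rw [← smul_sub, norm_smul, Real.norm_of_nonneg (deriv_smoothStep_nonneg hε0 x)]
    refine mul_le_mul_of_nonneg_left ?_ (deriv_smoothStep_nonneg hε0 x)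
    rw [← dist_eq_norm]
    refine (hδv x (hsub (Ioc_subset_Icc_self hx)) ?_).le
    rw [Real.dist_eq, abs_of_nonneg (by linarith [hx.1])]
    linarith [hx.2]
  rw [intervalIntegral.integral_mul_const, integral_deriv_smoothStep hε0] at h3
  linarith

/-- The difference of two steps converges to the indicator of `(s, t]` and is bounded by one;
dominated convergence applies. -/
theorem tendsto_integral_smoothStep_sub_smul (hg : LocallyIntegrableOn g (Ioo 0 T)) {s t : ℝ}
    (hs : 0 < s) (hst : s ≤ t) (ht : t < T) :
    Tendsto (fun ε => ∫ x in Ioo 0 T, (smoothStep s ε x - smoothStep t ε x) • g x)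
      (𝓝[>] 0) (𝓝 (∫ x in s..t, g x)) := by
  -- For small `ε` the cut-off vanishes outside `[s, t']`, a compact part of `(0, T)` on which `g`
  -- is integrable.
  obtain ⟨t', htt', ht'⟩ := exists_between ht
  have hsub : Icc s t' ⊆ Ioo 0 T := Icc_subset_Ioo hs ht'
  have hgI : IntegrableOn g (Icc s t') := hg.integrableOn_compact_subset hsub isCompact_Icc
  have hlim : ∀ a x : ℝ, Tendsto (fun ε => smoothStep a ε x) (𝓝[>] 0)
      (𝓝 ((Ioi a).indicator 1 x)) := by
    intro a x
    refine tendsto_const_nhds.congr' ?_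
    by_cases hx : a < x
    · filter_upwards [Ioo_mem_nhdsGT (sub_pos.2 hx)] with ε hε
      rw [indicator_of_mem (mem_Ioi.2 hx), smoothStep_of_ge hε.1 (by linarith [hε.2]),
        Pi.one_apply]
    · filter_upwards [self_mem_nhdsWithin] with ε hε
      rw [indicator_of_notMem (by simpa using hx), smoothStep_of_le hε (not_lt.1 hx)]
  have hIoc : ∫ x in s..t, g x = ∫ x in Icc s t', (Ioc s t).indicator g x := by
    rw [setIntegral_indicator measurableSet_Ioc, intervalIntegral.integral_of_le hst,
      inter_eq_self_of_subset_right (Ioc_subset_Icc_self.trans (Icc_subset_Icc_right htt'.le))]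
  rw [hIoc]
  have hdct : Tendsto (fun ε => ∫ x in Icc s t', (smoothStep s ε x - smoothStep t ε x) • g x)
      (𝓝[>] 0) (𝓝 (∫ x in Icc s t', (Ioc s t).indicator g x)) := by
    refine tendsto_integral_filter_of_dominated_convergence (fun x => ‖g x‖)
      (Eventually.of_forall fun ε => ?_) (Eventually.of_forall fun ε =>
        Eventually.of_forall fun x => ?_) hgI.norm (Eventually.of_forall fun x => ?_)
    · exact (contDiff_smoothStep.continuous.sub
        contDiff_smoothStep.continuous).aestronglyMeasurable.smul hgI.aestronglyMeasurable
    · rw [norm_smul]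
      refine mul_le_of_le_one_left (norm_nonneg _) ?_
      have h1 := Real.smoothTransition.nonneg ((x - s) / ε)
      have h2 := Real.smoothTransition.nonneg ((x - t) / ε)
      have h3 := Real.smoothTransition.le_one ((x - s) / ε)
      have h4 := Real.smoothTransition.le_one ((x - t) / ε)
      rw [Real.norm_eq_abs, abs_le, smoothStep, smoothStep]
      constructor <;> linarith
    · have h := ((hlim s x).sub (hlim t x)).smul_const (g x)
      convert h using 2
      by_cases hs' : s < x <;> by_cases ht' : t < x
      · simp [indicator, hs', ht', not_le.2 ht']
      · simp [indicator, hs', ht', not_lt.1 ht']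
      · exact absurd (hst.trans_lt ht') hs'
      · simp [indicator, hs', ht']
  refine hdct.congr' ?_
  filter_upwards [Ioo_mem_nhdsGT (sub_pos.2 htt')] with ε hε
  refine (setIntegral_eq_of_subset_of_forall_sdiff_eq_zero measurableSet_Ioo hsub
    fun x hx => ?_).symm
  rcases not_and_or.1 hx.2 with h | h
  · rw [smoothStep_of_le hε.1 (not_le.1 h).le,
      smoothStep_of_le hε.1 ((not_le.1 h).le.trans hst), sub_zero, zero_smul]
  · rw [smoothStep_of_ge hε.1 (by linarith [not_le.1 h, hε.2]),
      smoothStep_of_ge hε.1 (by linarith [not_le.1 h, hε.2]), sub_self, zero_smul]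

/-- The fundamental theorem of calculus for continuous functions in `W^{1,1}_loc`. -/
theorem HasWeakDerivOn.sub_eq_integral [CompleteSpace E] (h : HasWeakDerivOn T v g)
    (hv : ContinuousOn v (Ioo 0 T))
    {s t : ℝ} (hs : 0 < s) (hst : s ≤ t) (ht : t < T) : v t - v s = ∫ x in s..t, g x := by
  have h1 := (tendsto_integral_deriv_smoothStep_smul hv ⟨hs, hst.trans_lt ht⟩).sub
    (tendsto_integral_deriv_smoothStep_smul hv ⟨hs.trans_le hst, ht⟩)
  have h2 := (tendsto_integral_smoothStep_sub_smul h.locallyIntegrable_deriv hs hst ht).neg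
  have heq : v s - v t = -∫ x in s..t, g x := by
    refine tendsto_nhds_unique (h1.congr' ?_) h2
    filter_upwards [Ioo_mem_nhdsGT (sub_pos.2 ht)] with ε hε
    have hε0 : 0 < ε := hε.1
    have hεT : t + ε < T := by linarith [hε.2]
    have hsupp : Function.support (fun x => smoothStep s ε x - smoothStep t ε x)
        ⊆ Icc s (t + ε) := by
      intro x hx
      by_contra hx'
      refine hx ?_
      rcases not_and_or.1 hx' with h | h
      · simp only
        rw [smoothStep_of_le hε0 (not_le.1 h).le,
          smoothStep_of_le hε0 ((not_le.1 h).le.trans hst), sub_zero]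
      · simp only
        rw [smoothStep_of_ge hε0 (by linarith [not_le.1 h]),
          smoothStep_of_ge hε0 (not_le.1 h).le, sub_self]
    have htsupp : tsupport (fun x => smoothStep s ε x - smoothStep t ε x) ⊆ Icc s (t + ε) :=
      closure_minimal hsupp isClosed_Icc
    rw [← h.integral_by_parts (fun x => smoothStep s ε x - smoothStep t ε x)
      (contDiff_smoothStep.sub contDiff_smoothStep)
      (HasCompactSupport.intro isCompact_Icc fun x hx => by
        by_contra h0; exact hx (hsupp h0)) (htsupp.trans (Icc_subset_Ioo hs hεT)),
      ← integral_sub (integrableOn_deriv_smoothStep_smul hv hs hε0 (by linarith))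
        (integrableOn_deriv_smoothStep_smul hv (hs.trans_le hst) hε0 hεT)]
    refine integral_congr_ae (Eventually.of_forall fun x => ?_)
    have hd : ∀ a, DifferentiableAt ℝ (smoothStep a ε) x := fun a =>
      (contDiff_smoothStep.differentiable (by simp)).differentiableAt
    simp only
    rw [deriv_fun_sub (hd s) (hd t), sub_smul]
  rw [← neg_sub, heq, neg_neg]

end SmoothStep

/-! ### The total variation as a continuous seminorm, and its accretivity inequality. -/

section TotalVariation

variable {X : Type*} [MeasurableSpace X] {m : Kernel X X} {ν : Measure X}

theorem measurePreserving_fst_compProd [SFinite ν] [IsMarkovKernel m] :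
    MeasurePreserving Prod.fst (ν ⊗ₘ m) ν :=
  ⟨measurable_fst, Measure.fst_compProd ν m⟩

theorem measurePreserving_snd_compProd [SFinite ν] [IsSFiniteKernel m] (hinv : m.Invariant ν) :
    MeasurePreserving Prod.snd (ν ⊗ₘ m) ν :=
  ⟨measurable_snd, (Measure.snd_compProd ν m).trans hinv⟩

theorem totalVariation_eq_lintegral_compProd [SFinite ν] [IsSFiniteKernel m] {u : X → ℝ}
    (hu : Measurable u) :
    totalVariation m ν u = 1 / 2 * ∫⁻ z, ‖u z.2 - u z.1‖ₑ ∂(ν ⊗ₘ m) := by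
  rw [totalVariation, Measure.lintegral_compProd (by fun_prop)]
  simp_rw [Real.enorm_eq_ofReal_abs]

variable [IsFiniteMeasure ν] [IsMarkovKernel m]

/-- Invariance enters through the second projection: `ν`-null sets pull back to null sets of `ν ⊗ₘ
m` under both projections. -/
theorem totalVariation_congr_ae (hinv : m.Invariant ν) {u w : X → ℝ} (hu : Measurable u)
    (hw : Measurable w) (huw : u =ᵐ[ν] w) : totalVariation m ν u = totalVariation m ν w := by
  rw [totalVariation_eq_lintegral_compProd hu, totalVariation_eq_lintegral_compProd hw]
  congr 1
  refine lintegral_congr_ae ?_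
  filter_upwards [measurePreserving_fst_compProd.quasiMeasurePreserving.ae_eq_comp huw,
    (measurePreserving_snd_compProd hinv).quasiMeasurePreserving.ae_eq_comp huw] with z h1 h2
  simp only [Function.comp_apply] at h1 h2
  rw [h1, h2]

theorem totalVariation_le_eLpNorm (hinv : m.Invariant ν) {u : X → ℝ} (hu : Measurable u) :
    totalVariation m ν u ≤ eLpNorm u 1 ν := by
  rw [totalVariation_eq_lintegral_compProd hu, ← eLpNorm_one_eq_lintegral_enorm]
  have h1 := eLpNorm_comp_measurePreserving (p := 1) hu.aestronglyMeasurable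
    (measurePreserving_snd_compProd hinv)
  have h2 := eLpNorm_comp_measurePreserving (p := 1) hu.aestronglyMeasurable
    (measurePreserving_fst_compProd (m := m) (ν := ν))
  have h3 := eLpNorm_sub_le (p := 1) (μ := ν ⊗ₘ m)
    (hu.comp measurable_snd).aestronglyMeasurable (hu.comp measurable_fst).aestronglyMeasurable
    le_rfl
  rw [h1, h2, ← two_mul] at h3
  calc _ ≤ 1 / 2 * (2 * eLpNorm u 1 ν) := mul_le_mul_right h3 _
    _ = eLpNorm u 1 ν := by
      rw [← mul_assoc, one_div, ENNReal.inv_mul_cancel two_ne_zero ENNReal.ofNat_ne_top, one_mul]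

theorem totalVariation_lp_le (hinv : m.Invariant ν) (u : Lp ℝ 2 ν) :
    totalVariation m ν u ≤ ENNReal.ofReal (√(ν.real univ) * ‖u‖) := by
  refine (totalVariation_le_eLpNorm hinv (Lp.stronglyMeasurable u).measurable).trans ?_
  refine (eLpNorm_le_eLpNorm_mul_rpow_measure_univ (q := 2) (by norm_num)
    (Lp.aestronglyMeasurable u)).trans_eq ?_
  rw [mul_comm, ENNReal.ofReal_mul (Real.sqrt_nonneg _), Lp.norm_def,
    ENNReal.ofReal_toReal (Lp.eLpNorm_ne_top u)]
  congr 1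
  rw [Real.sqrt_eq_rpow, ← ENNReal.ofReal_rpow_of_nonneg measureReal_nonneg (by norm_num),
    measureReal_def, ENNReal.ofReal_toReal (measure_ne_top ν univ)]
  norm_num

theorem totalVariation_lp_ne_top (hinv : m.Invariant ν) (u : Lp ℝ 2 ν) :
    totalVariation m ν u ≠ ⊤ :=
  ne_top_of_le_ne_top ENNReal.ofReal_ne_top (totalVariation_lp_le hinv u)

theorem totalVariation_add_le {u w : X → ℝ} (hu : Measurable u) (hw : Measurable w) :
    totalVariation m ν (u + w) ≤ totalVariation m ν u + totalVariation m ν w := by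
  rw [totalVariation_eq_lintegral_compProd hu, totalVariation_eq_lintegral_compProd hw,
    totalVariation_eq_lintegral_compProd (hu.add hw), ← mul_add,
    ← lintegral_add_left (by fun_prop)]
  refine mul_le_mul_right (lintegral_mono fun z => ?_) _
  refine le_trans (le_of_eq ?_) (enorm_add_le _ _)
  simp only [Pi.add_apply]
  congr 1
  ring

theorem totalVariation_const_smul (c : ℝ) {u : X → ℝ} (hu : Measurable u) :
    totalVariation m ν (c • u) = ‖c‖ₑ * totalVariation m ν u := by
  rw [totalVariation_eq_lintegral_compProd hu, totalVariation_eq_lintegral_compProd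
    (hu.const_smul c), mul_left_comm, ← lintegral_const_mul ‖c‖ₑ (by fun_prop)]
  congr 1
  refine lintegral_congr fun z => ?_
  rw [← enorm_mul, Pi.smul_apply, Pi.smul_apply, smul_eq_mul, smul_eq_mul, mul_sub]

/-- The total variation as a seminorm on `L²(X, ν)`. -/
noncomputable def tvSeminorm (hinv : m.Invariant ν) : Seminorm ℝ (Lp ℝ 2 ν) :=
  Seminorm.of (fun u => (totalVariation m ν u).toReal)
    (fun u w => by
      rw [← ENNReal.toReal_add (totalVariation_lp_ne_top hinv u) (totalVariation_lp_ne_top hinv w)]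
      refine ENNReal.toReal_mono (ENNReal.add_ne_top.2
        ⟨totalVariation_lp_ne_top hinv u, totalVariation_lp_ne_top hinv w⟩) ?_
      rw [totalVariation_congr_ae hinv (Lp.stronglyMeasurable _).measurable
        ((Lp.stronglyMeasurable u).measurable.add (Lp.stronglyMeasurable w).measurable)
        (Lp.coeFn_add u w)]
      exact totalVariation_add_le (Lp.stronglyMeasurable u).measurable
        (Lp.stronglyMeasurable w).measurable)
    (fun c u => by
      rw [totalVariation_congr_ae hinv (Lp.stronglyMeasurable _).measurable
        ((Lp.stronglyMeasurable u).measurable.const_smul c) (Lp.coeFn_smul c u),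
        totalVariation_const_smul c (Lp.stronglyMeasurable u).measurable, ENNReal.toReal_mul,
        toReal_enorm])

theorem tvSeminorm_apply (hinv : m.Invariant ν) (u : Lp ℝ 2 ν) :
    tvSeminorm hinv u = (totalVariation m ν u).toReal := rfl

theorem tvSeminorm_le (hinv : m.Invariant ν) (u : Lp ℝ 2 ν) :
    tvSeminorm hinv u ≤ √(ν.real univ) * ‖u‖ :=
  ENNReal.toReal_le_of_le_ofReal (by positivity) (totalVariation_lp_le hinv u)

theorem energy_eq_tvSeminorm (hinv : m.Invariant ν) (u : Lp ℝ 2 ν) :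
    energy m ν u = (tvSeminorm hinv u : ℝ) := by
  rw [energy, tvSeminorm_apply, EReal.coe_ennreal_toReal (totalVariation_lp_ne_top hinv u)]

theorem mem_oneLaplacian_iff (hinv : m.Invariant ν) {u ξ : Lp ℝ 2 ν} :
    ξ ∈ oneLaplacian m ν u ↔
      ∀ w, tvSeminorm hinv u + ⟪-ξ, w - u⟫ ≤ tvSeminorm hinv w := by
  simp only [oneLaplacian, subdifferential, mem_ofPred_eq, energy_eq_tvSeminorm hinv]
  refine ⟨fun h w => by exact_mod_cast h.2 w, fun h => ⟨EReal.coe_lt_top _, fun w => ?_⟩⟩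
  exact_mod_cast h w

/-- With `s = a - a'`, `t = b - b'` and `c` the increment of `φ`, the number `c` lies between `0`
and `s - t`. So `s - c` and `t + c` lie between `s` and `t` and have the same sum, and convexity of
the absolute value concludes. -/
theorem abs_sub_add_abs_add_le {φ : ℝ → ℝ} (hφ : Monotone φ)
    (hφ1 : ∀ a b, a ≤ b → φ b - φ a ≤ b - a) (a b a' b' : ℝ) :
    |(a - φ (a - b)) - (a' - φ (a' - b'))| + |(b + φ (a - b)) - (b' + φ (a' - b'))|
      ≤ |a - a'| + |b - b'| := by
  rcases le_total (a - b) (a' - b') with h | h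
  · have h1 := hφ h
    have h2 := hφ1 _ _ h
    rcases abs_cases ((a - φ (a - b)) - (a' - φ (a' - b'))) with h3 | h3 <;>
    rcases abs_cases ((b + φ (a - b)) - (b' + φ (a' - b'))) with h4 | h4 <;>
    rcases abs_cases (a - a') with h5 | h5 <;>
    rcases abs_cases (b - b') with h6 | h6 <;> linarith
  · have h1 := hφ h
    have h2 := hφ1 _ _ h
    rcases abs_cases ((a - φ (a - b)) - (a' - φ (a' - b'))) with h3 | h3 <;>
    rcases abs_cases ((b + φ (a - b)) - (b' + φ (a' - b'))) with h4 | h4 <;>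
    rcases abs_cases (a - a') with h5 | h5 <;>
    rcases abs_cases (b - b') with h6 | h6 <;> linarith

/-- The inequality behind the complete accretivity of the `1`-Laplacian. -/
theorem tvSeminorm_sub_add_tvSeminorm_add_le (hinv : m.Invariant ν) {φ : ℝ → ℝ}
    (hφ : Monotone φ) (hφ1 : ∀ a b, a ≤ b → φ b - φ a ≤ b - a) {u w P : Lp ℝ 2 ν}
    (hP : P =ᵐ[ν] fun x => φ (u x - w x)) :
    tvSeminorm hinv (u - P) + tvSeminorm hinv (w + P)
      ≤ tvSeminorm hinv u + tvSeminorm hinv w := by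
  have hum := (Lp.stronglyMeasurable u).measurable
  have hwm := (Lp.stronglyMeasurable w).measurable
  have hφm := hφ.measurable
  have h1 : totalVariation m ν (u - P : Lp ℝ 2 ν)
      = totalVariation m ν (fun x => u x - φ (u x - w x)) := by
    refine totalVariation_congr_ae hinv (Lp.stronglyMeasurable _).measurable (by fun_prop) ?_
    filter_upwards [Lp.coeFn_sub u P, hP] with x hx hx'
    rw [hx, Pi.sub_apply, hx']
  have h2 : totalVariation m ν (w + P : Lp ℝ 2 ν)
      = totalVariation m ν (fun x => w x + φ (u x - w x)) := by
    refine totalVariation_congr_ae hinv (Lp.stronglyMeasurable _).measurable (by fun_prop) ?_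
    filter_upwards [Lp.coeFn_add w P, hP] with x hx hx'
    rw [hx, Pi.add_apply, hx']
  simp only [tvSeminorm_apply]
  rw [← ENNReal.toReal_add (totalVariation_lp_ne_top hinv _) (totalVariation_lp_ne_top hinv _),
    ← ENNReal.toReal_add (totalVariation_lp_ne_top hinv _) (totalVariation_lp_ne_top hinv _)]
  refine ENNReal.toReal_mono (ENNReal.add_ne_top.2
    ⟨totalVariation_lp_ne_top hinv u, totalVariation_lp_ne_top hinv w⟩) ?_
  rw [h1, h2, totalVariation_eq_lintegral_compProd hum, totalVariation_eq_lintegral_compProd hwm,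
    totalVariation_eq_lintegral_compProd (by fun_prop),
    totalVariation_eq_lintegral_compProd (by fun_prop), ← mul_add, ← mul_add,
    ← lintegral_add_left (by fun_prop), ← lintegral_add_left (by fun_prop)]
  refine mul_le_mul_right (lintegral_mono fun z => ?_) _
  simp only [Real.enorm_eq_ofReal_abs]
  rw [← ENNReal.ofReal_add (abs_nonneg _) (abs_nonneg _),
    ← ENNReal.ofReal_add (abs_nonneg _) (abs_nonneg _)]
  exact ENNReal.ofReal_le_ofReal (abs_sub_add_abs_add_le hφ hφ1 _ _ _ _)

end TotalVariation

/-! ### Decay of convex functionals along weakly differentiable curves. -/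

section ChainRule

theorem antitoneOn_of_uniformly_locally_antitone {G : ℝ → ℝ} {a b δ : ℝ} (hδ : 0 < δ)
    (hG : ∀ s ∈ Icc a b, ∀ t ∈ Icc a b, s ≤ t → t - s < δ → G t ≤ G s) :
    AntitoneOn G (Icc a b) := by
  have key : ∀ n : ℕ, ∀ s ∈ Icc a b, ∀ t ∈ Icc a b, s ≤ t → t - s ≤ n * (δ / 2) → G t ≤ G s := by
    intro n
    induction n with
    | zero =>
      intro s _ t _ hst h
      have : t = s := le_antisymm (by simpa using h) hst
      rw [this]
    | succ n ih =>
      intro s hs t ht hst h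
      push_cast at h
      rcases le_total (t - s) (δ / 2) with h' | h'
      · exact hG s hs t ht hst (by linarith)
      · have hmid : t - δ / 2 ∈ Icc a b := ⟨by linarith [hs.1], by linarith [ht.2]⟩
        exact (hG _ hmid t ht (by linarith) (by linarith)).trans
          (ih s hs _ hmid (by linarith) (by linarith))
  intro s hs t ht hst
  obtain ⟨n, hn⟩ := exists_nat_ge ((t - s) / (δ / 2))
  exact key n s hs t ht hst ((div_le_iff₀ (by linarith)).1 hn)

variable {H : Type*} [NormedAddCommGroup H] [InnerProductSpace ℝ H]

/-- A convex functional `Ψ` with Lipschitz gradient `Φ` decreases along a curve `u ∈ W^{1,1}_loc`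
whose derivative makes a nonpositive product with `Φ(u)`. -/
theorem le_initial_of_inner_weakDeriv_nonpos [CompleteSpace H] {Φ : H → H}
    (hΦ : LipschitzWith 1 Φ) {Ψ : H → ℝ} (hΨ : ∀ a b, Ψ a - Ψ b ≤ ⟪Φ a, a - b⟫)
    {T : ℝ} {u g : ℝ → H} (hu : ContinuousOn u (Icc 0 T)) (hug : HasWeakDerivOn T u g)
    (hneg : ∀ᵐ t ∂(volume.restrict (Ioo 0 T)), ⟪Φ (u t), g t⟫ ≤ 0) {t : ℝ} (ht : t ∈ Ioo 0 T) :
    Ψ (u t) ≤ Ψ (u 0) := by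
  -- The gradient inequality, read at `a` and at `b`, squeezes `Ψ a` between two expressions tending
  -- to `Ψ b`.
  have hΨc : Continuous Ψ := by
    refine continuous_iff_continuousAt.2 fun b => ?_
    have h1 : Tendsto (fun a => Ψ b + ⟪Φ b, a - b⟫) (𝓝 b) (𝓝 (Ψ b)) := by
      have : Continuous fun a => Ψ b + ⟪Φ b, a - b⟫ := by fun_prop
      simpa using this.tendsto b
    have h2 : Tendsto (fun a => Ψ b + ⟪Φ a, a - b⟫) (𝓝 b) (𝓝 (Ψ b)) := by
      have : Continuous fun a => Ψ b + ⟪Φ a, a - b⟫ := by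
        have := hΦ.continuous
        fun_prop
      simpa using this.tendsto b
    refine tendsto_of_tendsto_of_tendsto_of_le_of_le h1 h2 (fun a => ?_) (fun a => ?_)
    · have := hΨ b a
      rw [← neg_sub a b, inner_neg_right] at this
      linarith
    · linarith [hΨ a b]
  have hmono : ∀ s ∈ Ioo 0 t, Ψ (u t) ≤ Ψ (u s) := by
    intro s hs
    have hsub : Icc s t ⊆ Ioo 0 T := Icc_subset_Ioo hs.1 ht.2
    have hgI : IntegrableOn g (Icc s t) :=
      hug.locallyIntegrable_deriv.integrableOn_compact_subset hsub isCompact_Icc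
    have hii : ∀ x ∈ Icc s t, ∀ y ∈ Icc s t, IntervalIntegrable g volume x y := fun x hx y hy =>
      (hgI.mono_set (uIcc_subset_Icc hx hy)).intervalIntegrable
    have huc : ContinuousOn u (Icc s t) := hu.mono (hsub.trans Ioo_subset_Icc_self)
    have hunif := isCompact_Icc.uniformContinuousOn_of_continuous huc
    set N := ∫ r in s..t, ‖g r‖ with hN
    have hε : ∀ ε > 0, Ψ (u t) ≤ Ψ (u s) + ε * N := by
      intro ε hε
      obtain ⟨δ, hδ, hδu⟩ := Metric.uniformContinuousOn_iff.1 hunif ε hε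
      have hanti := antitoneOn_of_uniformly_locally_antitone hδ
        (G := fun r => Ψ (u r) - ε * ∫ x in s..r, ‖g x‖) (a := s) (b := t) (by
        intro x hx y hy hxy hlt
        have hxyI : Icc x y ⊆ Icc s t := Icc_subset_Icc hx.1 hy.2
        have hgxy := hii x hx y hy
        have hs' : s ∈ Icc s t := left_mem_Icc.2 hs.2.le
        have hdiff : u y - u x = ∫ r in x..y, g r :=
          hug.sub_eq_integral (hu.mono Ioo_subset_Icc_self) (hsub hx).1 hxy (hsub hy).2
        -- On a short interval `Φ` is frozen at the right endpoint. The error against `Φ (u r)` is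
        -- at most `ε ‖g r‖`, so the errors add up to `ε N` over `[s, t]`.
        have h1 : ⟪Φ (u y), u y - u x⟫ = ∫ r in x..y, ⟪Φ (u y), g r⟫ := by
          rw [hdiff, intervalIntegral.integral_of_le hxy, intervalIntegral.integral_of_le hxy,
            integral_inner hgxy.1]
        have h2 : ∫ r in x..y, ⟪Φ (u y), g r⟫ ≤ ∫ r in x..y, ε * ‖g r‖ := by
          have hneg' : ∀ᵐ r ∂(volume.restrict (Icc x y)), ⟪Φ (u r), g r⟫ ≤ 0 :=
            ae_restrict_of_ae_restrict_of_subset (hxyI.trans hsub) hneg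
          have hint : IntervalIntegrable (fun r => ⟪Φ (u y), g r⟫) volume x y :=
            ⟨hgxy.1.const_inner _, hgxy.2.const_inner _⟩
          refine intervalIntegral.integral_mono_ae_restrict hxy hint (hgxy.norm.const_mul ε) ?_
          filter_upwards [hneg', ae_restrict_mem measurableSet_Icc] with r hr hrI
          have h3 : ⟪Φ (u y), g r⟫ = ⟪Φ (u y) - Φ (u r), g r⟫ + ⟪Φ (u r), g r⟫ := by
            rw [inner_sub_left]; ring
          have h4 := real_inner_le_norm (Φ (u y) - Φ (u r)) (g r)
          have h5 : ‖Φ (u y) - Φ (u r)‖ ≤ ε := by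
            rw [← dist_eq_norm]
            refine (hΦ.dist_le_mul _ _).trans ?_
            rw [NNReal.coe_one, one_mul]
            refine (hδu y hy r (hxyI hrI) ?_).le
            rw [Real.dist_eq, abs_of_nonneg (by linarith [hrI.2])]
            linarith [hrI.1]
          have h6 := mul_le_mul_of_nonneg_right h5 (norm_nonneg (g r))
          linarith
        rw [intervalIntegral.integral_const_mul] at h2
        have h7 := intervalIntegral.integral_add_adjacent_intervals
          (hii s hs' x hx).norm hgxy.norm
        have h8 := hΨ (u y) (u x)
        rw [← h7]
        linarith)
      have := hanti (left_mem_Icc.2 hs.2.le) (right_mem_Icc.2 hs.2.le) hs.2.le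
      simp only [intervalIntegral.integral_same, mul_zero, sub_zero] at this
      linarith
    have hlim : Tendsto (fun ε => Ψ (u s) + ε * N) (𝓝[>] 0) (𝓝 (Ψ (u s))) := by
      have : Continuous fun ε => Ψ (u s) + ε * N := by fun_prop
      simpa using (this.tendsto 0).mono_left nhdsWithin_le_nhds
    refine ge_of_tendsto hlim ?_
    filter_upwards [self_mem_nhdsWithin] with ε h using hε ε h
  -- The derivative is only locally integrable in `(0, T)`, so the initial time is reached through
  -- continuity of `u` at `0`.
  have h0 : Tendsto (fun s => Ψ (u s)) (𝓝[>] 0) (𝓝 (Ψ (u 0))) := by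
    have h : ContinuousWithinAt u (Icc 0 T) 0 := hu 0 ⟨le_rfl, ht.1.le.trans ht.2.le⟩
    have h' : Tendsto u (𝓝[>] 0) (𝓝 (u 0)) :=
      h.mono_left (nhdsWithin_le_of_mem (mem_of_superset
        (Ioo_mem_nhdsGT (ht.1.trans ht.2)) Ioo_subset_Icc_self))
    exact (hΨc.tendsto _).comp h'
  refine ge_of_tendsto h0 ?_
  filter_upwards [Ioo_mem_nhdsGT ht.1] with s hs using hmono s hs

theorem HasWeakDerivOn.sub {T : ℝ} {v w v' w' : ℝ → H} (hv : HasWeakDerivOn T v v')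
    (hw : HasWeakDerivOn T w w') : HasWeakDerivOn T (v - w) (v' - w') := by
  refine ⟨hv.locallyIntegrable.sub hw.locallyIntegrable,
    hv.locallyIntegrable_deriv.sub hw.locallyIntegrable_deriv, fun φ hφ hφc hφs => ?_⟩
  have hint : ∀ {ψ : ℝ → ℝ} {g : ℝ → H}, LocallyIntegrableOn g (Ioo 0 T) → Continuous ψ →
      HasCompactSupport ψ → tsupport ψ ⊆ Ioo 0 T →
      IntegrableOn (fun t => ψ t • g t) (Ioo 0 T) := by
    intro ψ g hg hψ hψc hψs
    have h1 : IntegrableOn (fun t => ψ t • g t) (tsupport ψ) :=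
      (hg.integrableOn_compact_subset hψs hψc).continuousOn_smul hψ.continuousOn hψc
    refine h1.of_forall_sdiff_eq_zero measurableSet_Ioo fun x hx => ?_
    rw [image_eq_zero_of_notMem_tsupport hx.2, zero_smul]
  have hφ' : Continuous (deriv φ) := hφ.continuous_deriv (by simp)
  have hs' : tsupport (deriv φ) ⊆ Ioo 0 T := (tsupport_deriv_subset).trans hφs
  simp only [Pi.sub_apply, smul_sub]
  rw [integral_sub (hint hv.locallyIntegrable hφ' hφc.deriv hs')
      (hint hw.locallyIntegrable hφ' hφc.deriv hs'),
    integral_sub (hint hv.locallyIntegrable_deriv hφ.continuous hφc hφs)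
      (hint hw.locallyIntegrable_deriv hφ.continuous hφc hφs),
    hv.integral_by_parts φ hφ hφc hφs, hw.integral_by_parts φ hφ hφc hφs]
  abel

end ChainRule

/-! ### The test functions: truncated excesses and their primitives. -/

section Truncation

/-- The truncation `r ↦ min ((r - k)⁺) h`. -/
def truncation (k h r : ℝ) : ℝ := min (max (r - k) 0) h

/-- The primitive of `truncation k h` vanishing on `(-∞, k]`. -/
noncomputable def truncationPrimitive (k h r : ℝ) : ℝ :=
  (max (r - k) 0 ^ 2 - max (r - k - h) 0 ^ 2) / 2

variable {k h : ℝ}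

theorem monotone_truncation : Monotone (truncation k h) := fun a b hab =>
  min_le_min_right _ (max_le_max_right _ (by linarith))

theorem truncation_sub_le {a b : ℝ} (hab : a ≤ b) :
    truncation k h b - truncation k h a ≤ b - a := by
  unfold truncation
  grind

theorem lipschitzWith_truncation : LipschitzWith 1 (truncation k h) := by
  refine LipschitzWith.of_dist_le_mul fun a b => ?_
  rw [NNReal.coe_one, one_mul, Real.dist_eq, Real.dist_eq]
  rcases le_total a b with hab | hab
  · have := monotone_truncation (k := k) (h := h) hab
    rw [abs_sub_comm, abs_sub_comm a b, abs_of_nonneg (by linarith), abs_of_nonneg (by linarith)]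
    exact truncation_sub_le hab
  · have := monotone_truncation (k := k) (h := h) hab
    rw [abs_of_nonneg (by linarith), abs_of_nonneg (by linarith)]
    exact truncation_sub_le hab

theorem truncation_nonneg (hh : 0 ≤ h) (r : ℝ) : 0 ≤ truncation k h r :=
  le_min (le_max_right _ _) hh

theorem truncation_of_nonpos (hk : 0 ≤ k) (hh : 0 ≤ h) {r : ℝ} (hr : r ≤ 0) :
    truncation k h r = 0 := by
  rw [truncation, max_eq_right (by linarith), min_eq_left hh]

theorem mul_truncation_nonneg (hk : 0 ≤ k) (hh : 0 ≤ h) (r : ℝ) : 0 ≤ r * truncation k h r := by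
  rcases le_total r 0 with hr | hr
  · rw [truncation_of_nonpos hk hh hr, mul_zero]
  · exact mul_nonneg hr (truncation_nonneg hh r)

theorem truncation_cases (hh : 0 ≤ h) (r : ℝ) :
    (r ≤ k ∧ truncation k h r = 0 ∧ truncationPrimitive k h r = 0) ∨
    ((k ≤ r ∧ r ≤ k + h) ∧ truncation k h r = r - k ∧
      truncationPrimitive k h r = (r - k) ^ 2 / 2) ∨
    (k + h ≤ r ∧ truncation k h r = h ∧
      truncationPrimitive k h r = h * (r - k) - h ^ 2 / 2) := by
  unfold truncationPrimitive truncation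
  rcases le_total r k with h1 | h1
  · refine Or.inl ⟨h1, ?_, ?_⟩
    · rw [max_eq_right (by linarith), min_eq_left hh]
    · rw [max_eq_right (by linarith), max_eq_right (by linarith)]
      simp
  rcases le_total r (k + h) with h2 | h2
  · refine Or.inr (Or.inl ⟨⟨h1, h2⟩, ?_, ?_⟩)
    · rw [max_eq_left (by linarith), min_eq_left (by linarith)]
    · rw [max_eq_left (by linarith), max_eq_right (by linarith)]
      ring
  · refine Or.inr (Or.inr ⟨h2, ?_, ?_⟩)
    · rw [max_eq_left (by linarith), min_eq_right (by linarith)]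
    · rw [max_eq_left (by linarith), max_eq_left (by linarith)]
      ring

/-- This is the gradient inequality for a convex function, since the derivative `truncation k h` is
nondecreasing; the nine cases locate `a` and `b` among the three regimes. -/
theorem truncationPrimitive_sub_le (hh : 0 ≤ h) (a b : ℝ) :
    truncationPrimitive k h a - truncationPrimitive k h b ≤ truncation k h a * (a - b) := by
  rcases truncation_cases (k := k) hh a with ⟨h1, h2, h3⟩ | ⟨⟨h1, h1'⟩, h2, h3⟩ | ⟨h1, h2, h3⟩ <;>
  rcases truncation_cases (k := k) hh b with ⟨h4, h5, h6⟩ | ⟨⟨h4, h4'⟩, h5, h6⟩ | ⟨h4, h5, h6⟩ <;>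
  rw [h2, h3, h6]
  · simp
  · nlinarith [sq_nonneg (b - k)]
  · nlinarith [mul_nonneg hh (sub_nonneg.2 h4)]
  · nlinarith [mul_nonneg (sub_nonneg.2 h1) (sub_nonneg.2 h4), sq_nonneg (a - k)]
  · nlinarith [sq_nonneg (a - b)]
  · nlinarith [mul_nonneg (sub_nonneg.2 h1') (sub_nonneg.2 h4), sq_nonneg (h - (a - k))]
  · nlinarith [mul_nonneg hh (sub_nonneg.2 h4)]
  · nlinarith [sq_nonneg (b - k - h)]
  · linarith

theorem truncationPrimitive_nonneg (hh : 0 ≤ h) (r : ℝ) : 0 ≤ truncationPrimitive k h r := by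
  unfold truncationPrimitive
  have h1 : max (r - k - h) 0 ≤ max (r - k) 0 := max_le_max_right _ (by linarith)
  have h2 : 0 ≤ max (r - k - h) 0 := le_max_right _ _
  nlinarith

/-- Together with `le_truncationPrimitive` this shows that the primitive divided by `h` is within `h
/ 2` of the excess `(r - k)⁺`. -/
theorem truncationPrimitive_le (hh : 0 ≤ h) (r : ℝ) :
    truncationPrimitive k h r ≤ h * max (r - k) 0 := by
  unfold truncationPrimitive
  rcases max_cases (r - k) 0 with ⟨e1, h1⟩ | ⟨e1, h1⟩ <;>
  rcases max_cases (r - k - h) 0 with ⟨e2, h2⟩ | ⟨e2, h2⟩ <;>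
  rw [e1, e2] <;> nlinarith

theorem le_truncationPrimitive (hh : 0 ≤ h) (r : ℝ) :
    h * max (r - k) 0 - h ^ 2 / 2 ≤ truncationPrimitive k h r := by
  unfold truncationPrimitive
  rcases max_cases (r - k) 0 with ⟨e1, h1⟩ | ⟨e1, h1⟩ <;>
  rcases max_cases (r - k - h) 0 with ⟨e2, h2⟩ | ⟨e2, h2⟩ <;>
  rw [e1, e2] <;> nlinarith [sq_nonneg (r - k - h)]

theorem continuous_truncationPrimitive : Continuous (truncationPrimitive k h) := by
  unfold truncationPrimitive
  fun_prop

end Truncation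

/-! ### From excess integrals to `L^q` norms. -/

section LqNorm

variable {X : Type*} [MeasurableSpace X] {ν : Measure X}

/-- Taylor's formula with integral remainder: the weight is the second derivative of `k ^ r`, and
`ENNReal.ofReal (a - k)` is the positive part, so the integral stops at `a`. For `1 < r < 2` the
weight is singular at `0` but integrable. -/
theorem ofReal_rpow_eq_lintegral {r : ℝ} (hr : 1 < r) {a : ℝ} (ha : 0 ≤ a) :
    ENNReal.ofReal (a ^ r) = ∫⁻ k in Ioi (0 : ℝ),
      ENNReal.ofReal (a - k) * ENNReal.ofReal (r * (r - 1) * k ^ (r - 2)) := by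
  have hr1 : -1 < r - 2 := by linarith
  have hr2 : -1 < r - 1 := by linarith
  have hsplit : ∀ k ∈ Ioc 0 a, (a - k) * (r * (r - 1) * k ^ (r - 2))
      = a * (r * (r - 1)) * k ^ (r - 2) - r * (r - 1) * k ^ (r - 1) := by
    intro k hk
    have : k ^ (r - 1) = k ^ (r - 2) * k := by
      rw [← Real.rpow_add_one hk.1.ne']; congr 1; ring
    rw [this]; ring
  have hi1 : IntervalIntegrable (fun k => a * (r * (r - 1)) * k ^ (r - 2)) volume 0 a :=
    (intervalIntegral.intervalIntegrable_rpow' hr1).const_mul _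
  have hi2 : IntervalIntegrable (fun k => r * (r - 1) * k ^ (r - 1)) volume 0 a :=
    (intervalIntegral.intervalIntegrable_rpow' hr2).const_mul _
  have hval : ∫ k in Ioc 0 a, (a - k) * (r * (r - 1) * k ^ (r - 2)) = a ^ r := by
    rw [setIntegral_congr_fun measurableSet_Ioc hsplit, ← intervalIntegral.integral_of_le ha,
      intervalIntegral.integral_sub hi1 hi2, intervalIntegral.integral_const_mul,
      intervalIntegral.integral_const_mul, integral_rpow (Or.inl hr1), integral_rpow (Or.inl hr2)]
    rw [show r - 2 + 1 = r - 1 by ring, show r - 1 + 1 = r by ring,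
      Real.zero_rpow (by linarith), Real.zero_rpow (by linarith)]
    have h1 : r - 1 ≠ 0 := by linarith
    have h2 : r ≠ 0 := by linarith
    have h3 : a ^ r = a * a ^ (r - 1) := by
      rcases ha.eq_or_lt with h0 | h0
      · rw [← h0, Real.zero_rpow h2, zero_mul]
      · rw [mul_comm, ← Real.rpow_add_one h0.ne']; congr 1; ring
    rw [h3]
    field_simp
    ring
  have hnn : ∀ k ∈ Ioc 0 a, 0 ≤ (a - k) * (r * (r - 1) * k ^ (r - 2)) := fun k hk =>
    mul_nonneg (by linarith [hk.2]) (mul_nonneg (mul_nonneg (by linarith) (by linarith))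
      (Real.rpow_nonneg hk.1.le _))
  have hint : IntegrableOn (fun k => (a - k) * (r * (r - 1) * k ^ (r - 2))) (Ioc 0 a) := by
    refine IntegrableOn.congr_fun ?_ (fun k hk => (hsplit k hk).symm) measurableSet_Ioc
    exact (hi1.sub hi2).1
  rw [← hval, ofReal_integral_eq_lintegral_ofReal hint
    ((ae_restrict_iff' measurableSet_Ioc).2 (Eventually.of_forall hnn))]
  have hsub : Ioc 0 a ⊆ Ioi (0 : ℝ) := Ioc_subset_Ioi_self
  rw [← lintegral_indicator measurableSet_Ioc, ← lintegral_indicator measurableSet_Ioi]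
  refine lintegral_congr fun k => ?_
  by_cases hk : k ∈ Ioc 0 a
  · rw [indicator_of_mem hk, indicator_of_mem (hsub hk),
      ENNReal.ofReal_mul (by linarith [hk.2])]
  · rw [indicator_of_notMem hk]
    by_cases hk0 : k ∈ Ioi (0 : ℝ)
    · have : a < k := not_le.1 fun h => hk ⟨hk0, h⟩
      rw [indicator_of_mem hk0, ENNReal.ofReal_of_nonpos (by linarith), zero_mul]
    · rw [indicator_of_notMem hk0]

/-- Domination of all the integrals of the excesses `(· - k)⁺`, `k ≥ 0`, implies domination of all
`L^q` norms. -/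
theorem eLpNorm_le_of_forall_lintegral_excess_le [SFinite ν] {A B : X → ℝ} (hA : Measurable A)
    (hB : Measurable B) (hA0 : ∀ x, 0 ≤ A x) (hB0 : ∀ x, 0 ≤ B x)
    (h : ∀ k, 0 ≤ k → ∫⁻ x, ENNReal.ofReal (A x - k) ∂ν ≤ ∫⁻ x, ENNReal.ofReal (B x - k) ∂ν)
    {q : ℝ≥0∞} (hq : 1 ≤ q) : eLpNorm A q ν ≤ eLpNorm B q ν := by
  rcases eq_or_ne q ⊤ with rfl | hqt
  · rcases eq_or_ne (eLpNorm B ⊤ ν) ⊤ with hBt | hBt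
    · rw [hBt]; exact le_top
    -- For `q = ∞` the single level `k = ess sup B` suffices: its excess integral vanishes for `B`,
    -- hence for `A`.
    set k := (eLpNorm B ⊤ ν).toReal
    have hBk : ∀ᵐ x ∂ν, B x ≤ k := by
      filter_upwards [enorm_ae_le_eLpNormEssSup B ν] with x hx
      rw [← eLpNorm_exponent_top] at hx
      have := ENNReal.toReal_mono hBt hx
      rwa [toReal_enorm, Real.norm_of_nonneg (hB0 x)] at this
    have h1 : ∫⁻ x, ENNReal.ofReal (B x - k) ∂ν = 0 := by
      rw [lintegral_eq_zero_iff (by fun_prop)]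
      filter_upwards [hBk] with x hx
      exact ENNReal.ofReal_of_nonpos (by linarith)
    have h2 : ∫⁻ x, ENNReal.ofReal (A x - k) ∂ν = 0 :=
      le_antisymm ((h k ENNReal.toReal_nonneg).trans h1.le) zero_le
    rw [lintegral_eq_zero_iff (by fun_prop)] at h2
    rw [eLpNorm_exponent_top]
    refine eLpNormEssSup_le_of_ae_enorm_bound ?_
    filter_upwards [h2] with x hx
    have := ENNReal.ofReal_eq_zero.1 hx
    rw [Real.enorm_eq_ofReal (hA0 x)]
    exact ENNReal.ofReal_le_of_le_toReal (by linarith)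
  · have hq0 : q ≠ 0 := (zero_lt_one.trans_le hq).ne'
    have hr1 : 1 ≤ q.toReal := by
      have := ENNReal.toReal_mono hqt hq
      rwa [ENNReal.toReal_one] at this
    rw [eLpNorm_eq_lintegral_rpow_enorm_toReal hq0 hqt,
      eLpNorm_eq_lintegral_rpow_enorm_toReal hq0 hqt]
    refine ENNReal.rpow_le_rpow ?_ (by positivity)
    have hrw : ∀ {D : X → ℝ}, (∀ x, 0 ≤ D x) →
        ∫⁻ x, ‖D x‖ₑ ^ q.toReal ∂ν = ∫⁻ x, ENNReal.ofReal (D x ^ q.toReal) ∂ν := fun hD =>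
      lintegral_congr fun x => by
        rw [Real.enorm_eq_ofReal (hD x), ENNReal.ofReal_rpow_of_nonneg (hD x) (by linarith)]
    rw [hrw hA0, hrw hB0]
    -- The exponent `1` is the level `k = 0`; the weighted formula needs an exponent larger than
    -- `1`.
    rcases hr1.eq_or_lt with h1 | h1
    · rw [← h1]
      simpa using h 0 le_rfl
    · have hswap : ∀ {D : X → ℝ}, Measurable D → (∀ x, 0 ≤ D x) →
          ∫⁻ x, ENNReal.ofReal (D x ^ q.toReal) ∂ν = ∫⁻ k in Ioi (0 : ℝ),
            (∫⁻ x, ENNReal.ofReal (D x - k) ∂ν) *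
              ENNReal.ofReal (q.toReal * (q.toReal - 1) * k ^ (q.toReal - 2)) := by
        intro D hDm hD
        simp_rw [fun x => ofReal_rpow_eq_lintegral h1 (hD x)]
        rw [lintegral_lintegral_swap (by fun_prop)]
        refine lintegral_congr fun k => ?_
        rw [lintegral_mul_const _ (by fun_prop)]
      rw [hswap hA hA0, hswap hB hB0]
      refine setLIntegral_mono' measurableSet_Ioi fun k hk => ?_
      exact mul_le_mul_left (h k (le_of_lt hk)) _

end LqNorm

/-! ### Comparison, uniqueness and existence for the Cauchy problem. -/

section Contraction

variable {X : Type*} [MeasurableSpace X] {m : Kernel X X} {ν : Measure X}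

theorem real_inner_lp_eq_integral (a b : Lp ℝ 2 ν) : ⟪a, b⟫ = ∫ x, a x * b x ∂ν := by
  rw [L2.inner_def]
  refine integral_congr_ae (Eventually.of_forall fun x => ?_)
  simp [mul_comm]

theorem integrable_lp_mul (a b : Lp ℝ 2 ν) : Integrable (fun x => a x * b x) ν := by
  refine (L2.integrable_inner (𝕜 := ℝ) a b).congr (Eventually.of_forall fun x => ?_)
  simp [mul_comm]

variable [IsFiniteMeasure ν]

theorem integrable_lp (a : Lp ℝ 2 ν) : Integrable a ν := (Lp.memLp a).integrable (by norm_num)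

theorem integrable_excess (a : Lp ℝ 2 ν) (k : ℝ) : Integrable (fun x => max (a x - k) 0) ν :=
  ((integrable_lp a).sub (integrable_const k)).pos_part

theorem integrable_truncationPrimitive {k h : ℝ} (hh : 0 ≤ h) (a : Lp ℝ 2 ν) :
    Integrable (fun x => truncationPrimitive k h (a x)) ν := by
  refine ((integrable_excess a k).const_mul h).mono'
    (continuous_truncationPrimitive.comp_aestronglyMeasurable (Lp.aestronglyMeasurable a))
    (Eventually.of_forall fun x => ?_)
  rw [Real.norm_of_nonneg (truncationPrimitive_nonneg hh _)]
  exact truncationPrimitive_le hh _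

variable [IsMarkovKernel m]

/-- Strict form of the complete accretivity of `u ↦ -Δ₁ᵐ u + lam (u - f)`. -/
theorem inner_truncation_sub_nonpos (hinv : m.Invariant ν) {lam : ℝ} (hlam : 0 < lam)
    {f f' v w v' w' P : Lp ℝ 2 ν} (hf : ∀ᵐ x ∂ν, f x ≤ f' x)
    (hv : lam • (v - f) + v' ∈ oneLaplacian m ν v)
    (hw : lam • (w - f') + w' ∈ oneLaplacian m ν w) {k h : ℝ} (hk : 0 ≤ k) (hh : 0 ≤ h)
    (hP : P =ᵐ[ν] fun x => truncation k h (v x - w x)) : ⟪P, v' - w'⟫ ≤ 0 := by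
  rw [mem_oneLaplacian_iff hinv] at hv hw
  -- The two subgradient inequalities are added and the total variations cancel by `h3`. What
  -- remains besides `⟪P, v' - w'⟫` are the terms `lam ⟪v - w, P⟫` and `lam ⟪f' - f, P⟫`, both
  -- nonnegative.
  have h1 := hv (v - P)
  have h2 := hw (w + P)
  have h3 := tvSeminorm_sub_add_tvSeminorm_add_le hinv monotone_truncation
    (fun a b hab => truncation_sub_le hab) hP
  have h4 : 0 ≤ ⟪v - w, P⟫ := by
    rw [real_inner_lp_eq_integral]
    refine integral_nonneg_of_ae ?_
    filter_upwards [Lp.coeFn_sub v w, hP] with x hx hx'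
    rw [hx, hx', Pi.sub_apply]
    exact mul_truncation_nonneg hk hh _
  have h5 : 0 ≤ ⟪f' - f, P⟫ := by
    rw [real_inner_lp_eq_integral]
    refine integral_nonneg_of_ae ?_
    filter_upwards [Lp.coeFn_sub f' f, hP, hf] with x hx hx' hx''
    rw [hx, hx', Pi.sub_apply]
    exact mul_nonneg (by linarith) (truncation_nonneg hh _)
  rw [show v - P - v = -P by abel] at h1
  rw [show w + P - w = P by abel] at h2
  have h6 : ⟪P, v' - w'⟫ = ⟪-(lam • (v - f) + v'), -P⟫ + ⟪-(lam • (w - f') + w'), P⟫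
      - lam * ⟪v - w, P⟫ - lam * ⟪f' - f, P⟫ := by
    rw [real_inner_comm]
    simp only [inner_neg_left, inner_neg_right, inner_add_left, inner_sub_left,
      real_inner_smul_left]
    ring
  have h7 := mul_nonneg hlam.le h4
  have h8 := mul_nonneg hlam.le h5
  linarith

variable {lam : ℝ} {f f' v₀ w₀ : Lp ℝ 2 ν} {T : ℝ} {v w : ℝ → Lp ℝ 2 ν}

/-- Composition with the truncation is a 1-Lipschitz map of `L²` and the gradient of the convex
functional `∫ truncationPrimitive`, so the decay lemma applies to `v - w`. -/
theorem integral_truncationPrimitive_sub_le (hinv : m.Invariant ν) (hlam : 0 < lam)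
    (hf : ∀ᵐ x ∂ν, f x ≤ f' x) (hv : IsStrongSolution m ν lam f v₀ T v)
    (hw : IsStrongSolution m ν lam f' w₀ T w) {k h : ℝ} (hk : 0 ≤ k) (hh : 0 ≤ h)
    {t : ℝ} (ht : t ∈ Ioo 0 T) :
    ∫ x, truncationPrimitive k h ((v t - w t : Lp ℝ 2 ν) x) ∂ν
      ≤ ∫ x, truncationPrimitive k h ((v₀ - w₀ : Lp ℝ 2 ν) x) ∂ν := by
  obtain ⟨v', hv', hvi⟩ := hv.inclusion
  obtain ⟨w', hw', hwi⟩ := hw.inclusion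
  have h0 : truncation k h 0 = 0 := truncation_of_nonpos hk hh le_rfl
  have hlip : LipschitzWith 1 (truncation k h) := lipschitzWith_truncation
  rw [← hv.initial, ← hw.initial]
  refine le_initial_of_inner_weakDeriv_nonpos (u := v - w) (g := v' - w')
    (Ψ := fun u => ∫ x, truncationPrimitive k h (u x) ∂ν)
    (hlip.lipschitzWith_compLp h0 : LipschitzWith 1 (hlip.compLp h0 : Lp ℝ 2 ν → Lp ℝ 2 ν))
    (fun a b => ?_) (hv.continuousOn.sub hw.continuousOn) (hv'.sub hw') ?_ ht
  · rw [← integral_sub (integrable_truncationPrimitive hh a) (integrable_truncationPrimitive hh b),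
      real_inner_lp_eq_integral]
    refine integral_mono_ae ((integrable_truncationPrimitive hh a).sub
      (integrable_truncationPrimitive hh b)) (integrable_lp_mul _ _) ?_
    filter_upwards [hlip.coeFn_compLp h0 a, Lp.coeFn_sub a b] with x hx hx'
    rw [hx, hx', Function.comp_apply, Pi.sub_apply]
    exact truncationPrimitive_sub_le hh _ _
  · filter_upwards [hvi, hwi] with s hvs hws
    refine inner_truncation_sub_nonpos hinv hlam hf hvs hws hk hh ?_
    filter_upwards [hlip.coeFn_compLp h0 ((v - w) s), Lp.coeFn_sub (v s) (w s)] with x hx hx'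
    rw [hx, Function.comp_apply, Pi.sub_apply, hx', Pi.sub_apply]

/-- Dividing the truncated estimate by `h` leaves an error `h / 2 * ν X`, which vanishes as `h → 0`
because `ν` is finite. -/
theorem integral_excess_sub_le (hinv : m.Invariant ν) (hlam : 0 < lam)
    (hf : ∀ᵐ x ∂ν, f x ≤ f' x) (hv : IsStrongSolution m ν lam f v₀ T v)
    (hw : IsStrongSolution m ν lam f' w₀ T w) {k : ℝ} (hk : 0 ≤ k)
    {t : ℝ} (ht : t ∈ Ioo 0 T) :
    ∫ x, max ((v t - w t : Lp ℝ 2 ν) x - k) 0 ∂ν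
      ≤ ∫ x, max ((v₀ - w₀ : Lp ℝ 2 ν) x - k) 0 ∂ν := by
  set a := v t - w t
  set b := v₀ - w₀
  have key : ∀ h > 0, ∫ x, max (a x - k) 0 ∂ν ≤ ∫ x, max (b x - k) 0 ∂ν
      + h / 2 * ν.real univ := by
    intro h hh
    have h1 := integral_truncationPrimitive_sub_le hinv hlam hf hv hw hk hh.le ht
    have h2 : ∫ x, (h * max (a x - k) 0 - h ^ 2 / 2) ∂ν
        ≤ ∫ x, truncationPrimitive k h (a x) ∂ν :=
      integral_mono (((integrable_excess a k).const_mul h).sub (integrable_const _))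
        (integrable_truncationPrimitive hh.le a) fun x => le_truncationPrimitive hh.le _
    have h3 : ∫ x, truncationPrimitive k h (b x) ∂ν ≤ ∫ x, h * max (b x - k) 0 ∂ν :=
      integral_mono (integrable_truncationPrimitive hh.le b)
        ((integrable_excess b k).const_mul h) fun x => truncationPrimitive_le hh.le _
    rw [integral_sub ((integrable_excess a k).const_mul h) (integrable_const _),
      integral_const_mul, integral_const, smul_eq_mul] at h2
    rw [integral_const_mul] at h3
    have h4 : h * ∫ x, max (a x - k) 0 ∂ν
        ≤ h * (∫ x, max (b x - k) 0 ∂ν + h / 2 * ν.real univ) := by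
      have : h * (∫ x, max (b x - k) 0 ∂ν + h / 2 * ν.real univ)
        = h * ∫ x, max (b x - k) 0 ∂ν + ν.real univ * (h ^ 2 / 2) := by ring
      linarith
    exact le_of_mul_le_mul_left h4 hh
  have hlim : Tendsto (fun h => ∫ x, max (b x - k) 0 ∂ν + h / 2 * ν.real univ) (𝓝[>] 0)
      (𝓝 (∫ x, max (b x - k) 0 ∂ν)) := by
    have : Continuous fun h : ℝ => ∫ x, max (b x - k) 0 ∂ν + h / 2 * ν.real univ := by fun_prop
    simpa using (this.tendsto 0).mono_left nhdsWithin_le_nhds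
  refine ge_of_tendsto hlim ?_
  filter_upwards [self_mem_nhdsWithin] with h hh using key h hh

/-- The contraction and comparison principle for strong solutions in every `L^q`. -/
theorem eLpNorm_posPart_sub_le (hinv : m.Invariant ν) (hlam : 0 < lam)
    (hf : ∀ᵐ x ∂ν, f x ≤ f' x) (hv : IsStrongSolution m ν lam f v₀ T v)
    (hw : IsStrongSolution m ν lam f' w₀ T w) {q : ℝ≥0∞} (hq : 1 ≤ q)
    {t : ℝ} (ht : t ∈ Ioo 0 T) :
    eLpNorm (fun x => max (v t x - w t x) 0) q ν
      ≤ eLpNorm (fun x => max (v₀ x - w₀ x) 0) q ν := by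
  have hmeas : ∀ a b : Lp ℝ 2 ν, Measurable fun x => max (a x - b x) 0 := fun a b =>
    ((Lp.stronglyMeasurable a).measurable.sub (Lp.stronglyMeasurable b).measurable).max
      measurable_const
  have hint : ∀ (a b : Lp ℝ 2 ν) {k : ℝ}, 0 ≤ k →
      ∫⁻ x, ENNReal.ofReal (max (a x - b x) 0 - k) ∂ν
        = ENNReal.ofReal (∫ x, max ((a - b : Lp ℝ 2 ν) x - k) 0 ∂ν) := by
    intro a b k hk
    rw [ofReal_integral_eq_lintegral_ofReal (integrable_excess _ k)
      (Eventually.of_forall fun x => le_max_right _ _)]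
    refine lintegral_congr_ae ?_
    filter_upwards [Lp.coeFn_sub a b] with x hx
    rw [hx, Pi.sub_apply]
    rcases le_total (a x - b x) 0 with h | h
    · rw [max_eq_right h, max_eq_right (by linarith), ENNReal.ofReal_of_nonpos (by linarith),
        ENNReal.ofReal_zero]
    · rw [max_eq_left h, ENNReal.ofReal_max, ENNReal.ofReal_zero, max_eq_left zero_le]
  refine eLpNorm_le_of_forall_lintegral_excess_le (hmeas _ _) (hmeas _ _)
    (fun x => le_max_right _ _) (fun x => le_max_right _ _) (fun k hk => ?_) hq
  rw [hint _ _ hk, hint _ _ hk]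
  exact ENNReal.ofReal_le_ofReal (integral_excess_sub_le hinv hlam hf hv hw hk ht)

theorem IsStrongSolution.eqOn (hinv : m.Invariant ν) (hlam : 0 < lam) (hT : 0 < T)
    (hv : IsStrongSolution m ν lam f v₀ T v) (hw : IsStrongSolution m ν lam f v₀ T w) :
    EqOn w v (Icc 0 T) := by
  have hle : ∀ {a b : ℝ → Lp ℝ 2 ν}, IsStrongSolution m ν lam f v₀ T a →
      IsStrongSolution m ν lam f v₀ T b → ∀ t ∈ Ioo 0 T, a t ≤ b t := by
    intro a b ha hb t ht
    have h := eLpNorm_posPart_sub_le hinv hlam (Eventually.of_forall fun _ => le_rfl) ha hb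
      (q := 1) le_rfl ht
    simp only [sub_self, max_self] at h
    have h0 := le_antisymm (h.trans_eq eLpNorm_zero') zero_le
    have hm : AEStronglyMeasurable (fun x => max (a t x - b t x) 0) ν :=
      ((Lp.aestronglyMeasurable _).sub (Lp.aestronglyMeasurable _)).sup aestronglyMeasurable_const
    rw [eLpNorm_eq_zero_iff hm one_ne_zero] at h0
    rw [← Lp.coeFn_le]
    filter_upwards [h0] with x hx
    have : a t x - b t x ≤ 0 := (le_max_left _ _).trans_eq hx
    linarith
  have heq : EqOn w v (Ioo 0 T) := fun t ht => le_antisymm (hle hw hv t ht) (hle hv hw t ht)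
  refine heq.of_subset_closure hw.continuousOn hv.continuousOn Ioo_subset_Icc_self ?_
  rw [closure_Ioo hT.ne]

theorem exists_isStrongSolution [MeasurableSpace.CountablyGenerated X] (hinv : m.Invariant ν)
    (hlam : 0 < lam) (f v₀ : Lp ℝ 2 ν) (hT : 0 < T) :
    ∃ v : ℝ → Lp ℝ 2 ν, IsStrongSolution m ν lam f v₀ T v := by
  -- This lets instance search find that `L²` over a countably generated σ-algebra is second
  -- countable, as the weak derivative requires.
  have : Fact ((2 : ℝ≥0∞) ≠ ⊤) := ⟨ENNReal.ofNat_ne_top⟩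
  obtain ⟨v, g, h0, hc, hg, hi⟩ := exists_gradient_flow (tvSeminorm_le hinv)
    (Real.sqrt_nonneg _) hlam f v₀ hT
  refine ⟨v, hc.continuousOn, h0, g, hg, ?_⟩
  filter_upwards [hi] with t ht
  exact (mem_oneLaplacian_iff hinv).2 ht

end Contraction

end MetricRandomWalk

theorem mainTheorem6 {X : Type*} [MetricSpace X] [PolishSpace X]
    [MeasurableSpace X] [BorelSpace X]
    (m : ProbabilityTheory.Kernel X X) (hm : MetricRandomWalk.IsRandomWalk m)
    (ν : MeasureTheory.Measure X) [MeasureTheory.IsFiniteMeasure ν]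
    (hrev : m.IsReversible ν)
    (herg : MetricRandomWalk.IsErgodic m ((ν Set.univ)⁻¹ • ν))
    (lam : ℝ) (hlam : 0 < lam) :
    (∀ (f v₀ : MeasureTheory.Lp ℝ 2 ν) (T : ℝ), 0 < T →
      ∃ v : ℝ → MeasureTheory.Lp ℝ 2 ν,
        MetricRandomWalk.IsStrongSolution m ν lam f v₀ T v ∧
        ∀ w : ℝ → MeasureTheory.Lp ℝ 2 ν,
          MetricRandomWalk.IsStrongSolution m ν lam f v₀ T w → Set.EqOn w v (Set.Icc 0 T)) ∧
    (∀ (f f' v₀ w₀ : MeasureTheory.Lp ℝ 2 ν) (T : ℝ) (v w : ℝ → MeasureTheory.Lp ℝ 2 ν),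
      0 < T → (∀ᵐ x ∂ν, f x ≤ f' x) →
      MetricRandomWalk.IsStrongSolution m ν lam f v₀ T v →
      MetricRandomWalk.IsStrongSolution m ν lam f' w₀ T w →
      ∀ (q : ENNReal), 1 ≤ q → ∀ t ∈ Set.Ioo 0 T,
        MeasureTheory.eLpNorm (fun x => max (v t x - w t x) 0) q ν ≤
          MeasureTheory.eLpNorm (fun x => max (v₀ x - w₀ x) 0) q ν) := by
  have := hm.isMarkov
  have hinv := hrev.invariant
  refine ⟨fun f v₀ T hT => ?_, fun f f' v₀ w₀ T v w _ hf hv hw q hq t ht =>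
    MetricRandomWalk.eLpNorm_posPart_sub_le hinv hlam hf hv hw hq ht⟩
  obtain ⟨v, hv⟩ := MetricRandomWalk.exists_isStrongSolution hinv hlam f v₀ hT
  exact ⟨v, hv, fun w hw => hv.eqOn hinv hlam hT hw⟩
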